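/- For $r\ge 1$ let $\zeta_r(s_1,\dots,s_r)$ denote the meromorphic continuation to $\mathbb{C}^r$ of the Euler–Zagier sum $\sum_{1\le n_1<\cdots<n_r} n_1^{-s_1}\cdots n_r^{-s_r}$ (absolutely convergent when $\Re s_k>1$ for all $k$). A zero of $\zeta_r$ is a point at which $\zeta_r$ is holomorphic and vanishes. Let $r\ge 2$, let $$F_{r-1}(s_2,\dots,s_r)=\sum_{j=1}^{r-1}(-1)^{r-j+1}\zeta_j(s_{r-j+1},\dots,s_r)-(-1)^r ,$$ and let $\mathcal H_{r-1}$ be the set of all $(s_2,\dots,s_r)\in\mathbb{C}^{r-1}$ at which all the functions $\zeta_j(s_{r-j+1},\dots,s_r)$, $1\le j\le r-1$, are holomorphic and $F_{r-1}(s_2,\dots,s_r)=0$. (i) Let $D\subset\mathbb{C}^{r-1}$ be a bounded set whose closure contains no singularity of any of the functions $\zeta_j(s_{r-j+1},\dots,s_r)$, $1\le j\le r-1$. Then for zeros $(s_1,\dots,s_r)$ of $\zeta_r$ with $(s_2,\dots,s_r)\in D$, the point $(s_2,\dots,s_r)$ approaches $\mathcal H_{r-1}$ as $\Re s_1\to+\infty$,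 uniformly on $D$: for every $\varepsilon>0$ there is $R$ such that, whenever $(s_1,\dots,s_r)$ is a zero of $\zeta_r$ with $\Re s_1>R$ and $(s_2,\dots,s_r)\in D$, some point of $\mathcal H_{r-1}$ has distance less than $\varepsilon$ from $(s_2,\dots,s_r)$. In particular, if $(s_1^{(m)},\dots,s_r^{(m)})$, $m=1,2,\dots$, is a sequence of zeros of $\zeta_r$ with $\Re s_1^{(m)}\to+\infty$ and $(s_2^{(m)},\dots,s_r^{(m)})\in D$ for all $m$, then the points $(s_2^{(m)},\dots,s_r^{(m)})$ approach $\mathcal H_{r-1}$, that is, for every $\varepsilon>0$ all but finitely many of them have distance less than $\varepsilon$ from some point of $\mathcal H_{r-1}$, and a subsequence of $(s_2^{(m)},\dots,s_r^{(m)})$ converges to a point $(\rho_2,\dots,\rho_r)\in\mathcal H_{r-1}$. (ii) Conversely, for every $(\rho_2,\dots,\rho_r)\in\mathcal H_{r-1}$ there is a sequence $(s_1^{(m)},\dots,s_r^{(m)})$, $m=1,2,\dots$, of zeros of $\zeta_r$ such that $\Re s_1^{(m)}\to+\infty$ and $(s_2^{(m)},\dots,s_r^{(m)})\to(\rho_2,\dots,\rho_r)$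 as $m\to\infty$. -/

import Mathlib

open Filter Topology

noncomputable section

/-- The index set of the `r`-fold sum: tuples `1 ≤ n_1 < n_2 < ⋯ < n_r` of integers. -/
def MultiZetaIndex (r : ℕ) : Type :=
  {n : Fin r → ℕ // StrictMono n ∧ ∀ i, 1 ≤ n i}

/-- The Euler-Zagier series `∑_{1 ≤ n_1 < ⋯ < n_r} 1 / (n_1 ^ s_1 ⋯ n_r ^ s_r)`. -/
def multiZetaSeries (r : ℕ) (s : Fin r → ℂ) : ℂ :=
  ∑' n : MultiZetaIndex r, ∏ i, 1 / ((n.1 i : ℕ) : ℂ) ^ (s i)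

/-- The region `Re s_k > 1` for all `k`, on which the series converges absolutely. -/
def multiZetaHalfSpace (r : ℕ) : Set (Fin r → ℂ) :=
  {s | ∀ i, 1 < (s i).re}

/-- `f` is an analytic continuation of the `r`-fold Euler-Zagier series to the domain `U`:
`U` is open, connected and contains `Re s_k > 1` (for all `k`), `f` is holomorphic on `U`,
and `f` is given by the series where `Re s_k > 1` (for all `k`). -/
structure IsMultiZetaContinuation (r : ℕ) (U : Set (Fin r → ℂ)) (f : (Fin r → ℂ) → ℂ) :
    Prop where
  isOpen : IsOpen U
  isPreconnected : IsPreconnected U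
  halfSpace_subset : multiZetaHalfSpace r ⊆ U
  differentiableOn : DifferentiableOn ℂ f U
  eqOn : Set.EqOn f (multiZetaSeries r) (multiZetaHalfSpace r)

/-- The set of points of `ℂ^r` that are not singularities of `ζ_r`: the points to which the
series can be continued analytically. -/
def multiZetaRegular (r : ℕ) : Set (Fin r → ℂ) :=
  {s | ∃ (U : Set (Fin r → ℂ)) (f : (Fin r → ℂ) → ℂ), IsMultiZetaContinuation r U f ∧ s ∈ U}

open Classical in
/-- The multiple zeta-function `ζ_r`: its value at a regular point `s` is the value there of an
analytic continuation of the series. As the series has a (single-valued) meromorphic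
continuation to `ℂ^r`, this value does not depend on the continuation that is used.
At a singularity of `ζ_r` the value is set to `0`. -/
def multiZeta (r : ℕ) (s : Fin r → ℂ) : ℂ :=
  if h : ∃ (w : ℂ) (U : Set (Fin r → ℂ)) (f : (Fin r → ℂ) → ℂ),
      IsMultiZetaContinuation r U f ∧ s ∈ U ∧ f s = w
  then h.choose else 0

/-- The zeros of `ζ_r`, as a subset of the complement of the singularities. -/
def multiZetaZeros (r : ℕ) : Set (Fin r → ℂ) :=
  {s | s ∈ multiZetaRegular r ∧ multiZeta r s = 0}

/-- The last `j` of the `n` variables. -/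
def lastVars {n : ℕ} (j : ℕ) (hj : j ≤ n) (s : Fin n → ℂ) : Fin j → ℂ :=
  fun i => s ⟨n - j + i, by omega⟩

/-- The points `(s_2, …, s_r)` of `ℂ^{r-1}`, where `n = r - 1`, at which no function
`ζ_j(s_{r-j+1}, …, s_r)` with `1 ≤ j ≤ r - 1` is singular. The index `j` below is the `j` of
this formula minus one. -/
def tailRegular (n : ℕ) : Set (Fin n → ℂ) :=
  {s | ∀ j : Fin n, lastVars (j + 1) j.2 s ∈ multiZetaRegular (j + 1)}

/-- `F_{r-1}(s_2, …, s_r) = ∑_{j=1}^{r-1} (-1)^{r-j+1} ζ_j(s_{r-j+1}, …, s_r) - (-1)^r`, where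
`n = r - 1`. The index `j` below is the `j` of this formula minus one. -/
def tailF (n : ℕ) (s : Fin n → ℂ) : ℂ :=
  ∑ j : Fin n, (-1 : ℂ) ^ ((n + 1) - ((j : ℕ) + 1) + 1) *
    multiZeta (j + 1) (lastVars (j + 1) j.2 s) - (-1 : ℂ) ^ (n + 1)

/-- The hypersurface `F_{r-1}(s_2, …, s_r) = 0` in `ℂ^{r-1}`, where `n = r - 1`. -/
def tailHypersurface (n : ℕ) : Set (Fin n → ℂ) :=
  {s | s ∈ tailRegular n ∧ tailF n s = 0}

end

open Filter Topology

/-! ### Holomorphic functions of several variables along complex lines -/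

/-! For large `Re s_1`, the zeta-function is a Dirichlet series in its first variable: `ζ_r = ∑_{m ≥
1} m^{-s_1} T_m(s_2, …, s_r)`, where `T_m` continues the sum over `m < n_2 < ⋯ < n_r`. As `Re s_1 →
+∞` only the term `m = 1` survives, and `T_1` is `F_{r-1}`: removing the terms with smallest index
`1`, again and again, produces the alternating sum (`tailF_eq_tailZeta`). Hence `ζ_r → F_{r-1}`,
locally uniformly in `(s_2, …, s_r)` (`multiZeta_near_tailF`).

Part (i) follows by compactness of the closure of `D`: a limit of tails of zeros is a zero of
`F_{r-1}`. Part (ii) is Hurwitz's theorem on a complex line through `ρ` on which `F_{r-1}` is not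
identically zero (`exists_zero_near`). Such a line exists by the identity theorem, because the
common domain of the `ζ_j` is connected and `F_{r-1}(2, …, 2)` is a sum of positive terms.

Two facts support the expansion. The first is that `T_m` grows at most polynomially in `m`, locally
uniformly (`norm_tailZeta_le`); this comes from the recursion expressing `T_m` by a zeta value and a
finite sum of tails in fewer variables. The second is that `ζ_r` is single-valued on a connected
domain. To prove it, the series is summed over the last variable in Euler-Maclaurin fashion: each
integration by parts yields a telescoping term, which is a zeta-function in one variable less with
the last two variables merged, and a remainder with one more power of decay
(`exists_lastSeries_continuation`). All poles lie on the zero set of an entire function, a product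
of factors `1/Γ`. The complement of such a set is connected and dense, since a complex line not
inside the set meets it in countably many points. Two continuations therefore agree wherever both
are defined (`IsMultiZetaContinuation.eqOn_inter`). -/

/-- Go from `a` to a point of the perpendicular bisector of `[a, b]` and on to `b`. A point of `Z`
can lie on the broken line for at most one position of the corner per leg, so only countably many
corners near the midpoint are bad. -/
theorem JoinedIn.of_convex_diff_countable {C Z : Set ℂ} (hC : Convex ℝ C) (hCo : IsOpen C)
    (hZ : Z.Countable) {a b : ℂ} (ha : a ∈ C \ Z) (hb : b ∈ C \ Z) : JoinedIn (C \ Z) a b := by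
  rcases eq_or_ne a b with rfl | hab
  · exact JoinedIn.refl ha
  set m : ℝ → ℂ := fun t => (a + b) / 2 + t * (Complex.I * (b - a)) with hm
  -- In the coordinate `(z - a) / (b - a)` the leg from `a` is `u (1/2 + i σ t)`, so a point of it
  -- with `u ≠ 0` determines `σ t` as `im / (2 re)`. Exchanging `a` and `b` reverses the bisector;
  -- the sign `σ` lets the same claim serve both legs.
  have key : ∀ (a b : ℂ), a ≠ b → a ∈ C \ Z → ∀ (σ : ℝ) (t : ℝ),
      (a + b) / 2 + (σ * t : ℝ) * (Complex.I * (b - a)) ∈ C →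
      σ * t ∉ (fun z => ((z - a) / (b - a)).im / (2 * ((z - a) / (b - a)).re)) '' Z →
      segment ℝ a ((a + b) / 2 + (σ * t : ℝ) * (Complex.I * (b - a))) ⊆ C \ Z := by
    intro a b hab ha σ t htC ht z hz
    refine ⟨hC.segment_subset ha.1 htC hz, fun hzZ => ht ⟨z, hzZ, ?_⟩⟩
    rw [segment_eq_image'] at hz
    obtain ⟨u, -, rfl⟩ := hz
    have hba : b - a ≠ 0 := sub_ne_zero.2 hab.symm
    have hw : (a + u • ((a + b) / 2 + (σ * t : ℝ) * (Complex.I * (b - a)) - a) - a) / (b - a)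
        = (u : ℂ) * (1 / 2 + (σ * t : ℝ) * Complex.I) := by
      rw [Complex.real_smul]; field_simp; ring
    have hu : u ≠ 0 := by
      rintro rfl
      exact ha.2 (by simpa using hzZ)
    simp only [hw]
    simp
    field_simp
  have hcont : Continuous m := by fun_prop
  have h0 : m 0 ∈ C := by
    have := hC ha.1 hb.1 (a := (1 / 2 : ℝ)) (b := 1 / 2) (by norm_num) (by norm_num) (by norm_num)
    convert this using 1
    simp [hm]; ring
  have hU : IsOpen (m ⁻¹' C) := hCo.preimage hcont
  set B : Set ℝ := (fun z => ((z - a) / (b - a)).im / (2 * ((z - a) / (b - a)).re)) '' Z ∪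
    (fun z => -(((z - b) / (a - b)).im / (2 * ((z - b) / (a - b)).re))) '' Z with hB
  have hBc : B.Countable := (hZ.image _).union (hZ.image _)
  obtain ⟨t, htC, htB⟩ := (hBc.dense_compl ℝ).inter_open_nonempty _ hU ⟨0, h0⟩
  have h1 := key a b hab ha 1 t (by simpa [hm] using htC) (fun h => htB (Or.inl (by simpa using h)))
  have e2 : (b + a) / 2 + ((-1 * t : ℝ) : ℂ) * (Complex.I * (a - b)) = m t := by
    simp [hm]; ring
  have e1 : (a + b) / 2 + ((1 * t : ℝ) : ℂ) * (Complex.I * (b - a)) = m t := by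
    simp [hm]
  have h2 := key b a hab.symm hb (-1) t (by rw [e2]; exact htC) (fun h => htB (Or.inr (by
    obtain ⟨z, hz, hz'⟩ := h
    exact ⟨z, hz, by simp only at hz' ⊢; rw [hz']; ring⟩)))
  rw [e1] at h1
  rw [e2] at h2
  exact (JoinedIn.of_segment_subset h1).trans (JoinedIn.of_segment_subset h2).symm

section Several

variable {E : Type*} [NormedAddCommGroup E] [NormedSpace ℂ E]

/-- The zeros are isolated by the identity theorem, and a discrete subset of a hereditarily Lindelöf
space is countable. -/
theorem countable_zeros_of_differentiable {p : ℂ → ℂ} (hp : Differentiable ℂ p) {a : ℂ}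
    (ha : p a ≠ 0) : {t | p t = 0}.Countable := by
  have h := AnalyticOnNhd.preimage_zero_mem_codiscrete
    (hp.differentiableOn.analyticOnNhd isOpen_univ) ha
  rw [mem_codiscrete'] at h
  have := (HereditarilyLindelofSpace.isLindelof _).countable_of_isDiscrete h.2
  convert this using 1
  ext t; simp

theorem differentiable_complexLine (a v : E) : Differentiable ℂ (fun t : ℂ => a + t • v) := by
  fun_prop

theorem countable_zeros_on_line {P : E → ℂ} (hP : Differentiable ℂ P) (a v : E) {t₀ : ℂ}
    (h : P (a + t₀ • v) ≠ 0) : {t : ℂ | P (a + t • v) = 0}.Countable :=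
  countable_zeros_of_differentiable (hP.comp (differentiable_complexLine a v)) h

theorem convex_preimage_complexLine [NormedSpace ℝ E] [IsScalarTower ℝ ℂ E] {C : Set E}
    (hC : Convex ℝ C) (a v : E) :
    Convex ℝ ((fun t : ℂ => a + t • v) ⁻¹' C) := by
  intro x hx y hy α β hα hβ hαβ
  have := hC hx hy hα hβ hαβ
  simp only [Set.mem_preimage] at *
  convert this using 1
  rw [smul_add, smul_add, add_smul, smul_assoc, smul_assoc]
  have : a = α • a + β • a := by rw [← add_smul, hαβ, one_smul]
  nth_rewrite 1 [this]
  abel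

/-- The complex line through two points of the set meets the zeros of `P` in a countable set, so the
planar statement joins the points within that line. -/
theorem isPreconnected_convex_inter_ne_zero [NormedSpace ℝ E] [IsScalarTower ℝ ℂ E] {P : E → ℂ}
    (hP : Differentiable ℂ P) {C : Set E}
    (hC : Convex ℝ C) (hCo : IsOpen C) : IsPreconnected (C ∩ {x | P x ≠ 0}) := by
  refine isPreconnected_of_forall_pair fun a ha b hb => ?_
  set ℓ : ℂ → E := fun t => a + t • (b - a) with hℓ
  have hℓc : Continuous ℓ := (differentiable_complexLine a (b - a)).continuous
  have hcount : {t : ℂ | P (ℓ t) = 0}.Countable :=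
    countable_zeros_on_line hP a (b - a) (t₀ := 0) (by simpa using ha.2)
  have h0 : ℓ 0 = a := by simp [hℓ]
  have h1 : ℓ 1 = b := by simp [hℓ]
  have hj := JoinedIn.of_convex_diff_countable (convex_preimage_complexLine hC a (b - a))
    (hCo.preimage hℓc) hcount (a := 0) (b := 1) ⟨by change ℓ 0 ∈ C; rw [h0]; exact ha.1,
      by simpa [h0] using ha.2⟩ ⟨by change ℓ 1 ∈ C; rw [h1]; exact hb.1, by simpa [h1] using hb.2⟩
  obtain ⟨γ, hγ⟩ := hj
  refine ⟨Set.range (fun t => ℓ (γ t)), ?_, ⟨0, by simp [h0]⟩, ⟨1, by simp [h1]⟩,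
    isPreconnected_range (hℓc.comp γ.continuous)⟩
  rintro _ ⟨t, rfl⟩
  exact ⟨(hγ t).1, (hγ t).2⟩

theorem dense_ne_zero {P : E → ℂ} (hP : Differentiable ℂ P) {a : E} (ha : P a ≠ 0) :
    Dense {x | P x ≠ 0} := by
  intro x
  set ℓ : ℂ → E := fun t => x + t • (a - x) with hℓ
  have hℓc : Continuous ℓ := (differentiable_complexLine x (a - x)).continuous
  have hcount : {t : ℂ | P (ℓ t) = 0}.Countable :=
    countable_zeros_on_line hP x (a - x) (t₀ := 1) (by simpa using ha)
  have h0 : ℓ 0 = x := by simp [hℓ]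
  have := (hcount.dense_compl ℂ) 0
  have h2 := image_closure_subset_closure_image hℓc (Set.mem_image_of_mem ℓ this)
  rw [h0] at h2
  refine closure_mono ?_ h2
  rintro _ ⟨t, ht, rfl⟩
  exact ht

theorem eventually_nhds_line {p : E → Prop} {a : E} (v : E) (h : ∀ᶠ x in 𝓝 a, p x) :
    ∀ᶠ t : ℂ in 𝓝 0, p (a + t • v) := by
  have hc := (differentiable_complexLine a v).continuous.tendsto 0
  simp only [zero_smul, add_zero] at hc
  exact hc.eventually h

theorem eqOn_zero_of_convex [NormedSpace ℝ E] [IsScalarTower ℝ ℂ E] {C : Set E} (hC : Convex ℝ C)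
    (hCo : IsOpen C) {f : E → ℂ} (hf : DifferentiableOn ℂ f C) {a : E} (ha : a ∈ C)
    (h : ∀ᶠ x in 𝓝 a, f x = 0) : ∀ x ∈ C, f x = 0 := by
  intro x hx
  have hT := convex_preimage_complexLine hC a (x - a)
  have hTo := hCo.preimage (differentiable_complexLine a (x - a)).continuous
  have hd : DifferentiableOn ℂ (fun t : ℂ => f (a + t • (x - a)))
      ((fun t : ℂ => a + t • (x - a)) ⁻¹' C) :=
    hf.comp (differentiable_complexLine a (x - a)).differentiableOn fun t ht => ht
  have := (hd.analyticOnNhd hTo).eqOn_zero_of_preconnected_of_eventuallyEq_zero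
    hT.isPreconnected (z₀ := 0) (by simpa using ha) (eventually_nhds_line (x - a) h)
  simpa using this (show (1 : ℂ) ∈ _ by simpa using hx)

/-- The identity theorem. -/
theorem eqOn_zero_of_isPreconnected {U : Set E} (hU : IsOpen U)
    (hUc : IsPreconnected U) {f : E → ℂ} (hf : DifferentiableOn ℂ f U) {a : E} (ha : a ∈ U)
    (h : ∀ᶠ x in 𝓝 a, f x = 0) : ∀ x ∈ U, f x = 0 := by
  let _ : NormedSpace ℝ E := NormedSpace.restrictScalars ℝ ℂ E
  have : IsScalarTower ℝ ℂ E := IsScalarTower.of_algebraMap_smul fun r x => rfl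
  -- The points near which `f` vanishes form an open set. It is relatively closed in `U`: a ball
  -- around a limit point contains one of its points, and the convex case fills the ball.
  have hsub : U ⊆ {x | ∀ᶠ y in 𝓝 x, f y = 0} := by
    refine hUc.subset_of_closure_inter_subset isOpen_setOfPred_eventually_nhds ⟨a, ha, h⟩ ?_
    rintro x ⟨hx, hxU⟩
    obtain ⟨r, hr, hrU⟩ := Metric.isOpen_iff.1 hU x hxU
    obtain ⟨y, hyr, hy⟩ := mem_closure_iff.1 hx _ Metric.isOpen_ball (Metric.mem_ball_self hr)
    filter_upwards [Metric.ball_mem_nhds x hr] with z hz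
    exact eqOn_zero_of_convex (convex_ball x r) Metric.isOpen_ball (hf.mono hrU) hyr hy z hz
  exact fun x hx => (hsub hx).self_of_nhds

theorem eqOn_of_isPreconnected {U : Set E} (hU : IsOpen U)
    (hUc : IsPreconnected U) {f g : E → ℂ} (hf : DifferentiableOn ℂ f U)
    (hg : DifferentiableOn ℂ g U) {a : E} (ha : a ∈ U)
    (h : ∀ᶠ x in 𝓝 a, f x = g x) : ∀ x ∈ U, f x = g x := fun x hx =>
  sub_eq_zero.1 (eqOn_zero_of_isPreconnected hU hUc (hf.sub hg) ha
    (h.mono fun _ hy => by simp [hy]) x hx)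

/-- A holomorphic function on a connected open set agrees with a function that is holomorphic off
the zero set of an entire function as soon as they agree near one point. -/
theorem eqOn_of_isPreconnected_of_ne_zero {U : Set E} (hU : IsOpen U)
    (hUc : IsPreconnected U) {P : E → ℂ} (hP : Differentiable ℂ P) {f g : E → ℂ}
    (hf : DifferentiableOn ℂ f U) (hg : DifferentiableOn ℂ g {x | P x ≠ 0}) {a : E} (ha : a ∈ U)
    (haP : P a ≠ 0) (h : ∀ᶠ x in 𝓝 a, f x = g x) : ∀ x ∈ U, P x ≠ 0 → f x = g x := by
  let _ : NormedSpace ℝ E := NormedSpace.restrictScalars ℝ ℂ E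
  have : IsScalarTower ℝ ℂ E := IsScalarTower.of_algebraMap_smul fun r x => rfl
  have hG : IsOpen {x | P x ≠ 0} := isOpen_ne_fun hP.continuous continuous_const
  have hsub : U ⊆ {x | ∀ᶠ y in 𝓝 x, P y ≠ 0 → f y = g y} := by
    refine hUc.subset_of_closure_inter_subset isOpen_setOfPred_eventually_nhds
      ⟨a, ha, h.mono fun _ hy _ => hy⟩ ?_
    rintro x ⟨hx, hxU⟩
    obtain ⟨r, hr, hrU⟩ := Metric.isOpen_iff.1 hU x hxU
    obtain ⟨y, hyr, hy⟩ := mem_closure_iff.1 hx _ Metric.isOpen_ball (Metric.mem_ball_self hr)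
    obtain ⟨V, hV, hVo, hyV⟩ := eventually_nhds_iff.1 hy
    -- The point `y` may be a zero of `P`. A nearby `w` off the zero set starts the identity theorem
    -- on the ball minus that set, which is connected.
    obtain ⟨w, hw, hwP⟩ := (dense_ne_zero hP haP).inter_open_nonempty _
      (hVo.inter Metric.isOpen_ball) ⟨y, hyV, hyr⟩
    filter_upwards [Metric.ball_mem_nhds x hr] with z hz hzP
    refine eqOn_of_isPreconnected (Metric.isOpen_ball.inter hG)
      (isPreconnected_convex_inter_ne_zero hP (convex_ball x r) Metric.isOpen_ball)
      (hf.mono (Set.inter_subset_left.trans hrU)) (hg.mono Set.inter_subset_right)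
      ⟨hw.2, hwP⟩ ?_ z ⟨hz, hzP⟩
    filter_upwards [hVo.mem_nhds hw.1, hG.mem_nhds hwP] with v hv hvP using hV v hv hvP
  exact fun x hx hxP => (hsub hx).self_of_nhds hxP

/-- A set that contains the complement of the zero set of a nonzero entire function is connected. -/
theorem isPreconnected_of_ne_zero_subset {V : Set E} {P : E → ℂ} (hP : Differentiable ℂ P) {a : E}
    (ha : P a ≠ 0) (hV : {x | P x ≠ 0} ⊆ V) : IsPreconnected V := by
  let _ : NormedSpace ℝ E := NormedSpace.restrictScalars ℝ ℂ E
  have : IsScalarTower ℝ ℂ E := IsScalarTower.of_algebraMap_smul fun r x => rfl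
  have h := isPreconnected_convex_inter_ne_zero hP (convex_univ (𝕜 := ℝ)) isOpen_univ
  rw [Set.univ_inter] at h
  exact h.subset_closure hV fun x _ => dense_ne_zero hP ha x

/-- Cauchy's estimate in one variable, on the circle of radius `r / ‖v‖` in the complex line through
`x` with direction `v`. -/
theorem norm_fderiv_le_of_ball {f : E → ℂ} {x : E} {r M : ℝ} (hr : 0 < r) (hM : 0 ≤ M)
    (hf : DifferentiableOn ℂ f (Metric.ball x (2 * r)))
    (hb : ∀ y ∈ Metric.ball x (2 * r), ‖f y‖ ≤ M) : ‖fderiv ℂ f x‖ ≤ M / r := by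
  refine ContinuousLinearMap.opNorm_le_bound _ (by positivity) fun v => ?_
  rcases eq_or_ne v 0 with rfl | hv
  · simp
  have hv' : 0 < ‖v‖ := norm_pos_iff.2 hv
  have hmem : ∀ t ∈ Metric.closedBall (0 : ℂ) (r / ‖v‖), x + t • v ∈ Metric.ball x (2 * r) := by
    intro t ht
    rw [mem_closedBall_zero_iff, le_div_iff₀ hv'] at ht
    rw [mem_ball_iff_norm, add_sub_cancel_left, norm_smul]
    linarith
  have hx : x ∈ Metric.ball x (2 * r) := Metric.mem_ball_self (by positivity)
  have hfx := (hf.differentiableAt (Metric.isOpen_ball.mem_nhds hx)).hasFDerivAt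
  have hline : HasDerivAt (fun t : ℂ => x + t • v) v 0 := by
    simpa using ((hasDerivAt_id (0 : ℂ)).smul_const v).const_add x
  have hcomp : HasDerivAt (fun t : ℂ => f (x + t • v)) (fderiv ℂ f x v) 0 := by
    apply HasFDerivAt.comp_hasDerivAt (0 : ℂ) _ hline
    simpa using hfx
  have hdiff : DiffContOnCl ℂ (fun t : ℂ => f (x + t • v)) (Metric.ball 0 (r / ‖v‖)) := by
    refine DifferentiableOn.diffContOnCl_ball (U := Metric.closedBall 0 (r / ‖v‖)) ?_ le_rfl
    exact hf.comp (differentiable_complexLine x v).differentiableOn hmem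
  have := Complex.norm_deriv_le_of_forall_mem_sphere_norm_le (div_pos hr hv') hdiff (C := M)
    fun z hz => hb _ (hmem z (Metric.sphere_subset_closedBall hz))
  rw [hcomp.deriv] at this
  refine this.trans (le_of_eq ?_)
  field_simp

/-- A series of holomorphic functions of several variables that is locally dominated by a summable
series is holomorphic. -/
theorem differentiableOn_tsum_of_locally_summable {ι : Type*} {U : Set E} {F : ι → E → ℂ}
    (hF : ∀ i, DifferentiableOn ℂ (F i) U)
    (hb : ∀ x ∈ U, ∃ u : ι → ℝ, Summable u ∧ ∃ V ∈ 𝓝 x, V ⊆ U ∧ ∀ i, ∀ y ∈ V, ‖F i y‖ ≤ u i) :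
    DifferentiableOn ℂ (fun x => ∑' i, F i x) U := by
  let _ : NormedSpace ℝ E := NormedSpace.restrictScalars ℝ ℂ E
  intro x hx
  obtain ⟨u, hu, V, hV, hVU, hbV⟩ := hb x hx
  obtain ⟨r, hr, hrV⟩ := Metric.mem_nhds_iff.1 hV
  have hr3 : 0 < r / 3 := by positivity
  have hsub : ∀ y ∈ Metric.ball x (r / 3), Metric.ball y (2 * (r / 3)) ⊆ V := by
    intro y hy z hz
    refine hrV ?_
    rw [Metric.mem_ball] at *
    linarith [dist_triangle z y x]
  have hxr : x ∈ Metric.ball x (r / 3) := Metric.mem_ball_self hr3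
  -- Cauchy's estimate turns the majorant `u i` of the terms into the majorant `u i / (r / 3)` of
  -- their derivatives, so the series may be differentiated termwise.
  refine (hasFDerivAt_tsum_of_isPreconnected (f := F) (f' := fun i y => fderiv ℂ (F i) y)
    (hu.div_const (r / 3)) Metric.isOpen_ball (convex_ball x (r / 3)).isPreconnected
    (fun i y hy => ?_) (fun i y hy => ?_) hxr ?_ hxr).differentiableAt.differentiableWithinAt
  · have hyV : V ∈ 𝓝 y := Filter.mem_of_superset
      (Metric.ball_mem_nhds y (by positivity)) (hsub y hy)
    exact ((hF i).differentiableAt (Filter.mem_of_superset hyV hVU)).hasFDerivAt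
  · refine norm_fderiv_le_of_ball hr3 ((norm_nonneg _).trans (hbV i x (mem_of_mem_nhds hV)))
      ((hF i).mono ((hsub y hy).trans hVU)) fun z hz => hbV i z (hsub y hy hz)
  · exact Summable.of_norm_bounded hu fun i => hbV i x (mem_of_mem_nhds hV)

end Several

/-! ### Sums over strictly increasing tuples -/

/-- Strictly increasing `k`-tuples of natural numbers that satisfy `p`. -/
abbrev IncTuple (k : ℕ) (p : ℕ → Prop) : Type :=
  {n : Fin k → ℕ // StrictMono n ∧ ∀ i, p (n i)}

/-- The sum of `1 / (n_1 ^ s_1 ⋯ n_k ^ s_k)` over the increasing tuples that satisfy `p`. -/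
noncomputable def incSum (k : ℕ) (p : ℕ → Prop) (s : Fin k → ℂ) : ℂ :=
  ∑' n : IncTuple k p, ∏ i, 1 / ((n.1 i : ℕ) : ℂ) ^ (s i)

theorem multiZetaSeries_eq_incSum (k : ℕ) (s : Fin k → ℂ) :
    multiZetaSeries k s = incSum k (fun x => 0 < x) s := rfl

theorem incSum_congr {k : ℕ} {p q : ℕ → Prop} (h : ∀ x, p x ↔ q x) (s : Fin k → ℂ) :
    incSum k p s = incSum k q s := by
  rw [show p = q from funext fun x => propext (h x)]

instance (p : ℕ → Prop) : Unique (IncTuple 0 p) where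
  default := ⟨Fin.elim0, fun i => i.elim0, fun i => i.elim0⟩
  uniq _ := Subtype.ext (Subsingleton.elim _ _)

@[simp] theorem incSum_zero (p : ℕ → Prop) (s : Fin 0 → ℂ) : incSum 0 p s = 1 := by
  simp [incSum]

theorem Fin.strictMono_cons_iff {k : ℕ} {m : ℕ} {n : Fin k → ℕ} :
    StrictMono (Fin.cons m n : Fin (k + 1) → ℕ) ↔ StrictMono n ∧ ∀ i, m < n i := by
  constructor
  · intro h
    exact ⟨fun i j hij => by simpa using h (Fin.succ_lt_succ_iff.2 hij),
      fun i => by simpa using h (Fin.succ_pos i)⟩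
  · rintro ⟨h, hm⟩ i j hij
    induction j using Fin.cases with
    | zero => exact absurd hij (by simp)
    | succ j =>
      induction i using Fin.cases with
      | zero => simpa using hm j
      | succ i => simpa using h (Fin.succ_lt_succ_iff.1 hij)

theorem Fin.strictMono_snoc_iff {k : ℕ} {m : ℕ} {n : Fin k → ℕ} :
    StrictMono (Fin.snoc n m : Fin (k + 1) → ℕ) ↔ StrictMono n ∧ ∀ i, n i < m := by
  constructor
  · intro h
    exact ⟨fun i j hij => by simpa using h (Fin.castSucc_lt_castSucc_iff.2 hij),
      fun i => by simpa using h (Fin.castSucc_lt_last i)⟩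
  · rintro ⟨h, hm⟩ i j hij
    induction i using Fin.lastCases with
    | last => exact absurd hij (not_lt.2 (Fin.le_last j))
    | cast i =>
      induction j using Fin.lastCases with
      | last => simpa using hm i
      | cast j => simpa using h (Fin.castSucc_lt_castSucc_iff.1 hij)

/-- An increasing tuple consists of its first entry and the larger ones. -/
def IncTuple.consEquiv (k : ℕ) (p : ℕ → Prop) :
    (Σ m : {m // p m}, IncTuple k (fun x => p x ∧ m.1 < x)) ≃ IncTuple (k + 1) p where
  toFun n := ⟨Fin.cons n.1.1 n.2.1, Fin.strictMono_cons_iff.2 ⟨n.2.2.1, fun i => (n.2.2.2 i).2⟩,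
    fun i => by
      induction i using Fin.cases with
      | zero => simpa using n.1.2
      | succ i => simpa using (n.2.2.2 i).1⟩
  invFun n := ⟨⟨n.1 0, n.2.2 0⟩, ⟨Fin.tail n.1, fun i j hij => n.2.1 (Fin.succ_lt_succ_iff.2 hij),
    fun i => ⟨n.2.2 _, n.2.1 (Fin.succ_pos i)⟩⟩⟩
  left_inv n := by
    rcases n with ⟨⟨m, hm⟩, ⟨n, hn⟩⟩
    rfl
  right_inv n := Subtype.ext (Fin.cons_self_tail n.1)

/-- An increasing tuple consists of its last entry and the smaller ones. -/
def IncTuple.snocEquiv (k : ℕ) (p : ℕ → Prop) :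
    (Σ m : {m // p m}, IncTuple k (fun x => p x ∧ x < m.1)) ≃ IncTuple (k + 1) p where
  toFun n := ⟨Fin.snoc n.2.1 n.1.1, Fin.strictMono_snoc_iff.2 ⟨n.2.2.1, fun i => (n.2.2.2 i).2⟩,
    fun i => by
      induction i using Fin.lastCases with
      | last => simpa using n.1.2
      | cast i => simpa using (n.2.2.2 i).1⟩
  invFun n := ⟨⟨n.1 (Fin.last k), n.2.2 _⟩,
    ⟨Fin.init n.1, fun i j hij => n.2.1 (Fin.castSucc_lt_castSucc_iff.2 hij),
    fun i => ⟨n.2.2 _, n.2.1 (Fin.castSucc_lt_last i)⟩⟩⟩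
  left_inv n := by
    rcases n with ⟨⟨m, hm⟩, ⟨n, hn⟩⟩
    have h1 : (Fin.snoc n m : Fin (k + 1) → ℕ) (Fin.last k) = m := by simp
    refine Sigma.ext (Subtype.ext h1) ?_
    simp only [Fin.init_snoc]
    congr 1
    · funext x
      simp
    · simp
  right_inv n := Subtype.ext (Fin.snoc_init_self n.1)

theorem incSum_succ_snoc {k : ℕ} {p : ℕ → Prop} {s : Fin (k + 1) → ℂ}
    (hs : Summable fun n : IncTuple (k + 1) p => ∏ i, 1 / ((n.1 i : ℕ) : ℂ) ^ (s i)) :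
    incSum (k + 1) p s = ∑' m : {m // p m},
      incSum k (fun x => p x ∧ x < m.1) (Fin.init s) * (1 / ((m.1 : ℕ) : ℂ) ^ s (Fin.last k)) := by
  have h := Summable.tsum_sigma ((IncTuple.snocEquiv k p).summable_iff.2 hs)
  refine ((IncTuple.snocEquiv k p).tsum_eq _).symm.trans (h.trans ?_)
  refine tsum_congr fun m => ?_
  rw [incSum, ← tsum_mul_right]
  refine tsum_congr fun n => ?_
  refine (Fin.prod_univ_castSucc _).trans ?_
  simp [IncTuple.snocEquiv, Fin.init]

theorem summable_prod_pi : ∀ (k : ℕ) (f : Fin k → ℕ → ℝ), (∀ i n, 0 ≤ f i n) →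
    (∀ i, Summable (f i)) → Summable fun n : Fin k → ℕ => ∏ i, f i (n i)
  | 0, _, _, _ => Summable.of_finite
  | k + 1, f, h0, hf => by
    have ih := summable_prod_pi k (fun i => f i.succ) (fun i => h0 _) (fun i => hf _)
    have := (hf 0).mul_of_nonneg ih (h0 0) fun n => Finset.prod_nonneg fun i _ => h0 _ _
    refine (Fin.consEquiv (fun _ : Fin (k + 1) => ℕ)).summable_iff.1 (this.congr fun n => ?_)
    simp [Fin.prod_univ_succ, Fin.consEquiv]

/-! ### Absolute convergence and holomorphy in the half-space -/

theorem norm_one_div_natCast_cpow {n : ℕ} (hn : 0 < n) (s : ℂ) :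
    ‖1 / (n : ℂ) ^ s‖ = 1 / (n : ℝ) ^ s.re := by
  rw [norm_div, norm_one, Complex.norm_natCast_cpow_of_pos hn]

theorem summable_prod_one_div_rpow {k : ℕ} (σ : Fin k → ℝ) (hσ : ∀ i, 1 < σ i) (p : ℕ → Prop) :
    Summable fun n : IncTuple k p => ∏ i, 1 / ((n.1 i : ℕ) : ℝ) ^ σ i :=
  (summable_prod_pi k (fun i n => 1 / (n : ℝ) ^ σ i) (fun i n => by positivity)
    fun i => Real.summable_one_div_nat_rpow.2 (hσ i)).comp_injective Subtype.val_injective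

theorem norm_prod_one_div_le {k : ℕ} {n : Fin k → ℕ} (hn : ∀ i, 0 < n i) {s : Fin k → ℂ}
    {σ : Fin k → ℝ} (h : ∀ i, σ i ≤ (s i).re) :
    ‖∏ i, 1 / ((n i : ℕ) : ℂ) ^ (s i)‖ ≤ ∏ i, 1 / ((n i : ℕ) : ℝ) ^ σ i := by
  rw [norm_prod]
  refine Finset.prod_le_prod (fun i _ => norm_nonneg _) fun i _ => ?_
  rw [norm_one_div_natCast_cpow (hn i)]
  have h1 : (1 : ℝ) ≤ n i := by exact_mod_cast hn i
  exact one_div_le_one_div_of_le (by positivity) (Real.rpow_le_rpow_of_exponent_le h1 (h i))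

theorem summable_incTuple {k : ℕ} {p : ℕ → Prop} (hp : ∀ x, p x → 0 < x) {s : Fin k → ℂ}
    (hs : s ∈ multiZetaHalfSpace k) :
    Summable fun n : IncTuple k p => ∏ i, 1 / ((n.1 i : ℕ) : ℂ) ^ (s i) :=
  Summable.of_norm_bounded (summable_prod_one_div_rpow (fun i => (s i).re) hs p) fun n =>
    norm_prod_one_div_le (fun i => hp _ (n.2.2 i)) fun _ => le_rfl

theorem isOpen_multiZetaHalfSpace (k : ℕ) : IsOpen (multiZetaHalfSpace k) := by
  simp only [multiZetaHalfSpace, Set.ofPred_forall]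
  exact isOpen_iInter_of_finite fun i =>
    isOpen_lt continuous_const (Complex.continuous_re.comp (continuous_apply i))

theorem convex_multiZetaHalfSpace (k : ℕ) : Convex ℝ (multiZetaHalfSpace k) := by
  intro x hx y hy a b ha hb hab i
  have h1 := hx i
  have h2 := hy i
  simp only [Pi.add_apply, Pi.smul_apply, Complex.add_re, Complex.real_smul, Complex.mul_re,
    Complex.ofReal_re, Complex.ofReal_im, zero_mul, sub_zero]
  rcases ha.eq_or_lt with rfl | ha
  · have : b = 1 := by linarith
    subst this; linarith
  · nlinarith

theorem two_mem_multiZetaHalfSpace (k : ℕ) : (fun _ => 2 : Fin k → ℂ) ∈ multiZetaHalfSpace k :=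
  fun i => by norm_num

theorem differentiableAt_one_div_natCast_cpow {n : ℕ} (hn : 0 < n) (s : ℂ) :
    DifferentiableAt ℂ (fun s : ℂ => 1 / (n : ℂ) ^ s) s := by
  have h : (n : ℂ) ≠ 0 := by exact_mod_cast hn.ne'
  refine (differentiableAt_const _).div (differentiableAt_id.const_cpow (Or.inl h)) ?_
  simp [Complex.cpow_eq_zero_iff, h]

theorem differentiableAt_finsetProd {E ι : Type*} [NormedAddCommGroup E] [NormedSpace ℂ E]
    (u : Finset ι) {f : ι → E → ℂ} {x : E} (h : ∀ i ∈ u, DifferentiableAt ℂ (f i) x) :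
    DifferentiableAt ℂ (fun y => ∏ i ∈ u, f i y) x := by
  classical
  induction u using Finset.induction_on with
  | empty => simp
  | insert a u ha ih =>
    simp only [Finset.prod_insert ha]
    exact (h a (Finset.mem_insert_self a u)).mul
      (ih fun i hi => h i (Finset.mem_insert_of_mem hi))

theorem differentiableOn_multiZetaSeries (k : ℕ) :
    DifferentiableOn ℂ (multiZetaSeries k) (multiZetaHalfSpace k) := by
  refine differentiableOn_tsum_of_locally_summable (fun n => ?_) fun s hs => ?_
  · refine Differentiable.differentiableOn fun s => ?_
    refine differentiableAt_finsetProd _ fun i _ => ?_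
    exact DifferentiableAt.comp (g := fun z : ℂ => 1 / ((n.1 i : ℕ) : ℂ) ^ z) s
      (differentiableAt_one_div_natCast_cpow (n.2.2 i) (s i))
      (differentiableAt_apply (𝕜 := ℂ) i s)
  · refine ⟨_, summable_prod_one_div_rpow (fun i => (1 + (s i).re) / 2)
      (fun i => by have := hs i; linarith) (fun x => 1 ≤ x),
      {t | ∀ i, (1 + (s i).re) / 2 < (t i).re}, IsOpen.mem_nhds ?_ fun i => by
        have := hs i; linarith, fun t ht i => by
        have := hs i; have := ht i; linarith, fun n t ht => ?_⟩
    · simp only [Set.ofPred_forall]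
      exact isOpen_iInter_of_finite fun i =>
        isOpen_lt continuous_const (Complex.continuous_re.comp (continuous_apply i))
    · exact norm_prod_one_div_le (fun i => n.2.2 i) fun i => (ht i).le

/-! ### Tails of the Euler-Zagier series -/

/-- Reindexing of the integers greater than `N`. -/
def Nat.gtEquiv (N : ℕ) : ℕ ≃ {m // N < m} where
  toFun j := ⟨j + N + 1, by omega⟩
  invFun m := m.1 - (N + 1)
  left_inv j := by simp [add_assoc]
  right_inv m := Subtype.ext (by have := m.2; simp only; omega)

theorem Fin.tail_mem_multiZetaHalfSpace {k : ℕ} {s : Fin (k + 1) → ℂ}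
    (hs : s ∈ multiZetaHalfSpace (k + 1)) : Fin.tail s ∈ multiZetaHalfSpace k := fun _ => hs _

theorem incSum_gt_succ {k : ℕ} (N : ℕ) {s : Fin (k + 1) → ℂ}
    (hs : s ∈ multiZetaHalfSpace (k + 1)) :
    HasSum (fun j => 1 / ((j + N + 1 : ℕ) : ℂ) ^ s 0 * incSum k (fun x => j + N + 1 < x) (Fin.tail s))
      (incSum (k + 1) (fun x => N < x) s) := by
  have hsum := summable_incTuple (p := fun x => N < x) (fun x hx => by omega) hs
  have h1 := (IncTuple.consEquiv k (fun x => N < x)).summable_iff.2 hsum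
  have h3 := ((IncTuple.consEquiv k (fun x => N < x)).hasSum_iff.2 hsum.hasSum).sigma
    fun b => (h1.sigma_factor b).hasSum
  have h4 := (Nat.gtEquiv N).hasSum_iff.2 h3
  refine h4.congr_fun fun j => ?_
  have hp : ∀ x, j + N + 1 < x ↔ (N < x ∧ (Nat.gtEquiv N j).1 < x) := fun x => by
    simp only [Nat.gtEquiv, Equiv.coe_fn_mk]; omega
  rw [incSum_congr hp, incSum, ← tsum_mul_left]
  refine tsum_congr fun n => ?_
  simp only [Function.comp]
  symm
  refine (Fin.prod_univ_succ (M := ℂ) _).trans ?_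
  simp [IncTuple.consEquiv, Fin.tail, Nat.gtEquiv]

/-- The terms whose smallest index is at most `N` are removed from the full series. The right side
makes sense beyond the half-space, so it is the model for `tailZeta`. -/
theorem incSum_gt_eq_sub {k : ℕ} (N : ℕ) {s : Fin (k + 1) → ℂ}
    (hs : s ∈ multiZetaHalfSpace (k + 1)) :
    incSum (k + 1) (fun x => N < x) s = multiZetaSeries (k + 1) s -
      ∑ j ∈ Finset.range N, 1 / ((j + 1 : ℕ) : ℂ) ^ s 0 *
        incSum k (fun x => j + 1 < x) (Fin.tail s) := by
  have h0 := incSum_gt_succ 0 hs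
  have hN := incSum_gt_succ N hs
  rw [multiZetaSeries_eq_incSum, ← h0.tsum_eq, ← h0.summable.sum_add_tsum_nat_add N, ← hN.tsum_eq]
  simp

/-- All terms are positive reals. The case `N = 1` shows that `tailF` is not identically zero. -/
theorem incSum_gt_ne_zero (k N : ℕ) : incSum k (fun x => N < x) (fun _ => 2) ≠ 0 := by
  have hs := summable_prod_one_div_rpow (k := k) (fun _ => 2) (fun _ => by norm_num)
    (fun x => N < x)
  have hpos : 0 < ∑' n : IncTuple k (fun x => N < x), ∏ i, 1 / ((n.1 i : ℕ) : ℝ) ^ (2 : ℝ) := by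
    refine hs.tsum_pos (fun n => Finset.prod_nonneg fun i _ => by positivity)
      ⟨fun i => N + 1 + i, fun i j hij => by simpa using hij, fun i => by
        change N < N + 1 + _; omega⟩ ?_
    refine Finset.prod_pos fun i _ => ?_
    have : (0 : ℝ) < ((N + 1 + i : ℕ) : ℝ) := by positivity
    positivity
  have : incSum k (fun x => N < x) (fun _ => 2) =
      ((∑' n : IncTuple k (fun x => N < x), ∏ i, 1 / ((n.1 i : ℕ) : ℝ) ^ (2 : ℝ) : ℝ) : ℂ) := by
    rw [incSum, Complex.ofReal_tsum]
    refine tsum_congr fun n => ?_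
    push_cast
    refine Finset.prod_congr rfl fun i _ => ?_
    rw [Complex.ofReal_cpow (by positivity)]
    simp
  rw [this]
  exact_mod_cast hpos.ne'

/-! ### Summation over the last variable -/

/-- The finite sum of `1 / (n_1 ^ s_1 ⋯ n_k ^ s_k)` over `1 ≤ n_1 < ⋯ < n_k ≤ N`. -/
noncomputable def headSum : (k : ℕ) → (Fin k → ℂ) → ℕ → ℂ
  | 0, _, _ => 1
  | k + 1, s, N => ∑ j ∈ Finset.range N,
      headSum k (Fin.init s) j * (1 / ((j + 1 : ℕ) : ℂ) ^ s (Fin.last k))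

/-- The Euler-Zagier series in `k + 1` variables, summed over the last index. -/
noncomputable def lastSeries (k : ℕ) (s : Fin (k + 1) → ℂ) : ℂ :=
  ∑' j : ℕ, headSum k (Fin.init s) j * (1 / ((j + 1 : ℕ) : ℂ) ^ s (Fin.last k))

theorem finite_incTuple (k N : ℕ) : Finite (IncTuple k (fun x => 0 < x ∧ x < N + 1)) := by
  refine Finite.of_injective (β := Fin k → Fin (N + 1))
    (fun n i => ⟨n.1 i, (n.2.2 i).2⟩) fun m n h => Subtype.ext (funext fun i => ?_)
  simpa using congrFun h i

theorem incSum_eq_headSum : ∀ (k : ℕ) (s : Fin k → ℂ) (N : ℕ),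
    incSum k (fun x => 0 < x ∧ x < N + 1) s = headSum k s N
  | 0, s, N => by simp [headSum]
  | k + 1, s, N => by
    have := finite_incTuple (k + 1) N
    rw [incSum_succ_snoc Summable.of_finite, headSum]
    let e : Fin N ≃ {m // 0 < m ∧ m < N + 1} :=
      { toFun := fun j => ⟨j + 1, by omega⟩
        invFun := fun m => ⟨m.1 - 1, by have := m.2; omega⟩
        left_inv := fun j => by simp
        right_inv := fun m => Subtype.ext (by have := m.2; simp only; omega) }
    rw [← e.tsum_eq, tsum_fintype, Finset.sum_range]
    refine Finset.sum_congr rfl fun j _ => ?_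
    rw [← incSum_eq_headSum k]
    congr 1
    refine incSum_congr (fun x => ?_) _
    simp only [e, Equiv.coe_fn_mk]
    omega

theorem multiZetaSeries_eq_lastSeries {k : ℕ} {s : Fin (k + 1) → ℂ}
    (hs : s ∈ multiZetaHalfSpace (k + 1)) : multiZetaSeries (k + 1) s = lastSeries k s := by
  rw [multiZetaSeries_eq_incSum, incSum_succ_snoc (summable_incTuple (fun _ h => h) hs),
    lastSeries, ← (Nat.gtEquiv 0).tsum_eq]
  refine tsum_congr fun j => ?_
  rw [← incSum_eq_headSum k]
  congr 1

/-! ### Kernels of Euler-Maclaurin type -/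

/-- The integral of `p (x - N) x ^ (-s)` over `[N, N + 1]`, with value `0` for `N = 0`. -/
noncomputable def kern (p : ℝ → ℝ) (s : ℂ) (N : ℕ) : ℂ :=
  if N = 0 then 0 else ∫ t in (0 : ℝ)..1, (p t : ℂ) * (((N : ℝ) + t : ℝ) : ℂ) ^ (-s)

/-- The primitive of `p - ∫ p` on `[0, 1]` that vanishes at both ends. -/
noncomputable def meanPrim (p : ℝ → ℝ) (t : ℝ) : ℝ :=
  ∫ u in (0 : ℝ)..t, (p u - ∫ v in (0 : ℝ)..1, p v)

theorem hasDerivAt_meanPrim {p : ℝ → ℝ} (hp : Continuous p) (t : ℝ) :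
    HasDerivAt (meanPrim p) (p t - ∫ v in (0 : ℝ)..1, p v) t := by
  have hc : Continuous fun u => p u - ∫ v in (0 : ℝ)..1, p v := hp.sub continuous_const
  exact intervalIntegral.integral_hasDerivAt_right (hc.intervalIntegrable _ _)
    hc.aestronglyMeasurable.stronglyMeasurableAtFilter hc.continuousAt

theorem continuous_meanPrim {p : ℝ → ℝ} (hp : Continuous p) : Continuous (meanPrim p) :=
  continuous_iff_continuousAt.2 fun t => (hasDerivAt_meanPrim hp t).continuousAt

theorem meanPrim_zero (p : ℝ → ℝ) : meanPrim p 0 = 0 := by simp [meanPrim]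

theorem meanPrim_one {p : ℝ → ℝ} (hp : Continuous p) : meanPrim p 1 = 0 := by
  rw [meanPrim, intervalIntegral.integral_sub (hp.intervalIntegrable _ _)
    (continuous_const.intervalIntegrable _ _)]
  simp

theorem hasDerivAt_ofReal_add_cpow {N : ℕ} (c : ℂ) {t : ℝ} (ht : 0 < (N : ℝ) + t) :
    HasDerivAt (fun t : ℝ => (((N : ℝ) + t : ℝ) : ℂ) ^ c)
      (c * (((N : ℝ) + t : ℝ) : ℂ) ^ (c - 1)) t := by
  have h1 : HasDerivAt (fun t : ℝ => (((N : ℝ) + t : ℝ) : ℂ)) 1 t := by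
    simpa using ((hasDerivAt_id t).const_add (N : ℝ)).ofReal_comp
  have h2 : HasDerivAt (fun z : ℂ => z ^ c) (c * (((N : ℝ) + t : ℝ) : ℂ) ^ (c - 1))
      (((N : ℝ) + t : ℝ) : ℂ) := by
    simpa using (hasDerivAt_id (((N : ℝ) + t : ℝ) : ℂ)).cpow_const (c := c)
      (Complex.ofReal_mem_slitPlane.2 ht)
  exact (h2.comp t h1).congr_deriv (mul_one _)

theorem continuousOn_ofReal_add_cpow {N : ℕ} (hN : 0 < N) (c : ℂ) :
    ContinuousOn (fun t : ℝ => (((N : ℝ) + t : ℝ) : ℂ) ^ c) (Set.uIcc 0 1) := fun t ht =>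
  (hasDerivAt_ofReal_add_cpow c (by
    rw [Set.uIcc_of_le zero_le_one] at ht
    have h : (0 : ℝ) < N := by exact_mod_cast hN
    linarith [ht.1])).continuousAt.continuousWithinAt

/-- Integration by parts after splitting off the mean of `p`. The mean gives a difference of
consecutive values, which telescopes in `N`. The rest has a primitive vanishing at both ends, so it
leaves no boundary term and gains one power of decay. -/
theorem kern_eq {p : ℝ → ℝ} (hp : Continuous p) {s : ℂ} (hs : s ≠ 1) {N : ℕ} (hN : 0 < N) :
    kern p s N = ((∫ v in (0 : ℝ)..1, p v : ℝ) : ℂ) *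
      (((N : ℂ) ^ (1 - s) - ((N + 1 : ℕ) : ℂ) ^ (1 - s)) / (s - 1)) +
        s * kern (meanPrim p) (s + 1) N := by
  set m : ℝ := ∫ v in (0 : ℝ)..1, p v with hm
  have hs1 : s - 1 ≠ 0 := sub_ne_zero.2 hs
  have hs2 : 1 - s ≠ 0 := sub_ne_zero.2 hs.symm
  have hpos : ∀ t ∈ Set.uIcc (0 : ℝ) 1, 0 < (N : ℝ) + t := fun t ht => by
    rw [Set.uIcc_of_le zero_le_one] at ht
    have h : (0 : ℝ) < N := by exact_mod_cast hN
    linarith [ht.1]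
  have hi1 : IntervalIntegrable (fun t : ℝ => (p t : ℂ) * (((N : ℝ) + t : ℝ) : ℂ) ^ (-s))
      MeasureTheory.volume 0 1 := ContinuousOn.intervalIntegrable
    ((Complex.continuous_ofReal.comp hp).continuousOn.mul (continuousOn_ofReal_add_cpow hN _))
  have hi2 : IntervalIntegrable (fun t : ℝ => s * ((meanPrim p t : ℂ) *
      (((N : ℝ) + t : ℝ) : ℂ) ^ (-(s + 1)))) MeasureTheory.volume 0 1 :=
    ContinuousOn.intervalIntegrable (continuousOn_const.mul
      ((Complex.continuous_ofReal.comp (continuous_meanPrim hp)).continuousOn.mul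
        (continuousOn_ofReal_add_cpow hN _)))
  have hd : ∀ t ∈ Set.uIcc (0 : ℝ) 1, HasDerivAt
      (fun t : ℝ => (meanPrim p t : ℂ) * (((N : ℝ) + t : ℝ) : ℂ) ^ (-s) +
        (m : ℂ) * ((((N : ℝ) + t : ℝ) : ℂ) ^ (1 - s) / (1 - s)))
      ((p t : ℂ) * (((N : ℝ) + t : ℝ) : ℂ) ^ (-s) - s * ((meanPrim p t : ℂ) *
        (((N : ℝ) + t : ℝ) : ℂ) ^ (-(s + 1)))) t := by
    intro t ht
    have h1 := (hasDerivAt_meanPrim hp t).ofReal_comp.mul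
      (hasDerivAt_ofReal_add_cpow (-s) (hpos t ht))
    have h2 := ((hasDerivAt_ofReal_add_cpow (1 - s) (hpos t ht)).div_const (1 - s)).const_mul (m : ℂ)
    refine (h1.add h2).congr_deriv ?_
    rw [show -(s + 1) = -s - 1 by ring, show 1 - s - 1 = -s by ring, mul_div_assoc,
      mul_comm (1 - s), div_mul_cancel₀ _ hs2, ← hm]
    push_cast
    ring
  have h := intervalIntegral.integral_eq_sub_of_hasDerivAt hd (hi1.sub hi2)
  rw [intervalIntegral.integral_sub hi1 hi2, intervalIntegral.integral_const_mul, meanPrim_zero,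
    meanPrim_one hp] at h
  rw [kern, kern, if_neg hN.ne', if_neg hN.ne', ← sub_eq_iff_eq_add, h]
  push_cast
  field_simp
  ring_nf

theorem meanPrim_const (c : ℝ) : meanPrim (fun _ => c) = fun _ => 0 := by
  funext t; simp [meanPrim]

theorem kern_one_eq {s : ℂ} (hs : s ≠ 1) {N : ℕ} (hN : 0 < N) :
    kern (fun _ => 1) s N = ((N : ℂ) ^ (1 - s) - ((N + 1 : ℕ) : ℂ) ^ (1 - s)) / (s - 1) := by
  rw [kern_eq continuous_const hs hN, meanPrim_const]
  simp [kern]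

/-- Integrate the derivative of `t (N + t)^{-s}` over `[0, 1]`. -/
theorem one_div_cpow_eq_kern {s : ℂ} {N : ℕ} (hN : 0 < N) :
    1 / ((N + 1 : ℕ) : ℂ) ^ s = kern (fun _ => 1) s N - s * kern id (s + 1) N := by
  have hpos : ∀ t ∈ Set.uIcc (0 : ℝ) 1, 0 < (N : ℝ) + t := fun t ht => by
    rw [Set.uIcc_of_le zero_le_one] at ht
    have h : (0 : ℝ) < N := by exact_mod_cast hN
    linarith [ht.1]
  have hi1 : IntervalIntegrable (fun t : ℝ => (((1 : ℝ) : ℝ) : ℂ) * (((N : ℝ) + t : ℝ) : ℂ) ^ (-s))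
      MeasureTheory.volume 0 1 := ContinuousOn.intervalIntegrable
    (continuousOn_const.mul (continuousOn_ofReal_add_cpow hN _))
  have hi2 : IntervalIntegrable (fun t : ℝ => s * (((id t : ℝ) : ℂ) *
      (((N : ℝ) + t : ℝ) : ℂ) ^ (-(s + 1)))) MeasureTheory.volume 0 1 :=
    ContinuousOn.intervalIntegrable (continuousOn_const.mul
      (Complex.continuous_ofReal.continuousOn.mul (continuousOn_ofReal_add_cpow hN _)))
  have hd : ∀ t ∈ Set.uIcc (0 : ℝ) 1, HasDerivAt
      (fun t : ℝ => (t : ℂ) * (((N : ℝ) + t : ℝ) : ℂ) ^ (-s))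
      ((((1 : ℝ) : ℝ) : ℂ) * (((N : ℝ) + t : ℝ) : ℂ) ^ (-s) - s * (((id t : ℝ) : ℂ) *
        (((N : ℝ) + t : ℝ) : ℂ) ^ (-(s + 1)))) t := by
    intro t ht
    have h1 := (hasDerivAt_id t).ofReal_comp.mul (hasDerivAt_ofReal_add_cpow (-s) (hpos t ht))
    refine h1.congr_deriv ?_
    rw [show -(s + 1) = -s - 1 by ring]
    simp only [id]
    push_cast
    ring
  have h := intervalIntegral.integral_eq_sub_of_hasDerivAt hd (hi1.sub hi2)
  rw [intervalIntegral.integral_sub hi1 hi2, intervalIntegral.integral_const_mul s] at h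
  rw [kern, kern, if_neg hN.ne', if_neg hN.ne', h, Complex.cpow_neg]
  simp

theorem differentiable_kern {p : ℝ → ℝ} (hp : Continuous p) (N : ℕ) :
    Differentiable ℂ (fun s => kern p s N) := by
  rcases N.eq_zero_or_pos with rfl | hN
  · simp [kern]
  simp only [kern, if_neg hN.ne']
  intro s₀
  have hN' : (0 : ℝ) < N := by exact_mod_cast hN
  have hpos : ∀ t ∈ Set.Icc (0 : ℝ) 1, 0 < (N : ℝ) + t := fun t ht => by linarith [ht.1]
  set F' : ℂ → ℝ → ℂ := fun s t => (p t : ℂ) * ((((N : ℝ) + t : ℝ) : ℂ) ^ (-s) *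
    Complex.log (((N : ℝ) + t : ℝ) : ℂ) * (-1)) with hF'
  have hslit : ∀ t ∈ Set.Icc (0 : ℝ) 1, (((N : ℝ) + t : ℝ) : ℂ) ∈ Complex.slitPlane := fun t ht =>
    Complex.ofReal_mem_slitPlane.2 (hpos t ht)
  have hbase : ContinuousOn (fun x : ℂ × ℝ => (((N : ℝ) + x.2 : ℝ) : ℂ))
      (Metric.closedBall s₀ 1 ×ˢ Set.Icc 0 1) := by fun_prop
  have hcont : ContinuousOn (fun x : ℂ × ℝ => F' x.1 x.2)
      (Metric.closedBall s₀ 1 ×ˢ Set.Icc 0 1) := by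
    refine (Complex.continuous_ofReal.comp (hp.comp continuous_snd)).continuousOn.mul
      (((hbase.cpow continuous_fst.neg.continuousOn ?_).mul
        (hbase.clog ?_)).mul continuousOn_const)
    · exact fun x hx => hslit _ hx.2
    · exact fun x hx => hslit _ hx.2
  obtain ⟨C, hC⟩ := ((isCompact_closedBall s₀ 1).prod isCompact_Icc).exists_bound_of_continuousOn
    hcont
  have hsub : Set.uIoc (0 : ℝ) 1 ⊆ Set.Icc 0 1 := by
    rw [Set.uIoc_of_le zero_le_one]; exact Set.Ioc_subset_Icc_self
  have hFc : ∀ s : ℂ, ContinuousOn (fun t : ℝ => (p t : ℂ) * (((N : ℝ) + t : ℝ) : ℂ) ^ (-s))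
      (Set.uIcc 0 1) := fun s =>
    (Complex.continuous_ofReal.comp hp).continuousOn.mul (continuousOn_ofReal_add_cpow hN _)
  have hFi := fun s => (hFc s).intervalIntegrable (μ := MeasureTheory.volume)
  refine (intervalIntegral.hasDerivAt_integral_of_dominated_loc_of_deriv_le
    (F' := F') (bound := fun _ => C) (Metric.closedBall_mem_nhds s₀ one_pos)
    (Eventually.of_forall fun s => ((hFi s).def').aestronglyMeasurable) (hFi s₀) ?_ ?_
    (continuous_const.intervalIntegrable _ _) ?_).2.differentiableAt
  · have : ContinuousOn (F' s₀) (Set.Icc 0 1) :=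
      hcont.comp (f := fun t : ℝ => (s₀, t)) (by fun_prop)
        fun t ht => ⟨Metric.mem_closedBall_self zero_le_one, ht⟩
    exact ((this.mono hsub).aestronglyMeasurable measurableSet_uIoc)
  · exact Eventually.of_forall fun t ht s hs => hC (s, t) ⟨hs, hsub ht⟩
  · refine Eventually.of_forall fun t ht s hs => ?_
    have h0 : (((N : ℝ) + t : ℝ) : ℂ) ≠ 0 := Complex.slitPlane_ne_zero (hslit t (hsub ht))
    exact ((hasDerivAt_id s).neg.const_cpow (Or.inl h0)).const_mul (p t : ℂ)

theorem rpow_neg_le_two_rpow_mul {N : ℕ} (hN : 0 < N) {σ : ℝ} (hσ : 0 ≤ σ) :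
    (N : ℝ) ^ (-σ) ≤ 2 ^ σ * ((N : ℝ) + 1) ^ (-σ) := by
  have h1 : (1 : ℝ) ≤ N := by exact_mod_cast hN
  rw [Real.rpow_neg (by positivity), Real.rpow_neg (by positivity), ← div_eq_mul_inv,
    ← Real.div_rpow (by norm_num) (by positivity), ← Real.inv_rpow (by positivity)]
  refine Real.rpow_le_rpow (by positivity) ?_ hσ
  rw [inv_le_comm₀ (by positivity) (by positivity), inv_div]
  linarith

/-- The base `N + 1` in place of `N` costs the factor `2 ^ s.re` and makes the bound meaningful at
`N = 0`. -/
theorem norm_kern_le {p : ℝ → ℝ} (hp : Continuous p) :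
    ∃ C : ℝ, 0 ≤ C ∧ ∀ (N : ℕ) (s : ℂ), 0 ≤ s.re →
      ‖kern p s N‖ ≤ C * 2 ^ s.re * ((N : ℝ) + 1) ^ (-s.re) := by
  obtain ⟨C, hC⟩ := (isCompact_Icc (a := (0 : ℝ)) (b := 1)).exists_bound_of_continuousOn
    hp.continuousOn
  have hC0 : 0 ≤ C := (norm_nonneg _).trans (hC 0 (by simp))
  refine ⟨C, hC0, fun N s hs => ?_⟩
  rcases N.eq_zero_or_pos with rfl | hN
  · simp only [kern, if_true, norm_zero]; positivity
  have hN' : (0 : ℝ) < N := by exact_mod_cast hN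
  rw [kern, if_neg hN.ne']
  refine (intervalIntegral.norm_integral_le_of_norm_le_const (C := C * (N : ℝ) ^ (-s.re))
    fun t ht => ?_).trans ?_
  · rw [Set.uIoc_of_le zero_le_one] at ht
    have hpos : 0 < (N : ℝ) + t := by linarith [ht.1]
    rw [norm_mul, Complex.norm_real, Complex.norm_cpow_eq_rpow_re_of_pos hpos, Complex.neg_re]
    refine mul_le_mul (hC t ⟨ht.1.le, ht.2⟩) ?_ (by positivity) hC0
    exact Real.rpow_le_rpow_of_nonpos hN' (by linarith [ht.1]) (by linarith)
  · rw [sub_zero, abs_one, mul_one, mul_assoc]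
    exact mul_le_mul_of_nonneg_left (rpow_neg_le_two_rpow_mul hN hs) hC0

/-! ### Head sums -/

theorem headSum_succ (k : ℕ) (s : Fin (k + 1) → ℂ) (N : ℕ) : headSum (k + 1) s N =
    ∑ j ∈ Finset.range N, headSum k (Fin.init s) j * (1 / ((j + 1 : ℕ) : ℂ) ^ s (Fin.last k)) :=
  rfl

-- This makes the convention `kern p s 0 = 0` harmless: the kernels are only paired with head sums
-- of positive depth.
@[simp] theorem headSum_succ_zero (k : ℕ) (s : Fin (k + 1) → ℂ) : headSum (k + 1) s 0 = 0 := by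
  simp [headSum_succ]

theorem norm_one_div_cpow_le (j : ℕ) (z : ℂ) :
    ‖1 / ((j + 1 : ℕ) : ℂ) ^ z‖ ≤ ((j : ℝ) + 1) ^ ‖z‖ := by
  rw [norm_one_div_natCast_cpow (Nat.succ_pos j), one_div, ← Real.rpow_neg (by positivity)]
  push_cast
  refine Real.rpow_le_rpow_of_exponent_le (by linarith [(Nat.cast_nonneg j : (0 : ℝ) ≤ j)]) ?_
  exact (neg_le_abs _).trans (Complex.abs_re_le_norm z)

/-- A crude bound suffices: each summation costs one power of `N + 1` and each factor at most `‖s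
i‖` powers. What matters is that the exponent is continuous in `s`. -/
theorem norm_headSum_le : ∀ (k : ℕ) (s : Fin k → ℂ) (N : ℕ),
    ‖headSum k s N‖ ≤ ((N : ℝ) + 1) ^ ((k : ℝ) + ∑ i, ‖s i‖)
  | 0, s, N => by simp [headSum]
  | k + 1, s, N => by
    rw [headSum_succ]
    have hterm : ∀ j ∈ Finset.range N,
        ‖headSum k (Fin.init s) j * (1 / ((j + 1 : ℕ) : ℂ) ^ s (Fin.last k))‖ ≤
          ((N : ℝ) + 1) ^ ((k : ℝ) + ∑ i, ‖s i‖) := by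
      intro j hj
      have hj' : (j : ℝ) + 1 ≤ (N : ℝ) + 1 := by
        have : (j : ℝ) < N := by exact_mod_cast Finset.mem_range.1 hj
        linarith
      rw [norm_mul]
      refine (mul_le_mul (norm_headSum_le k _ j) (norm_one_div_cpow_le j _) (norm_nonneg _)
        (by positivity)).trans ?_
      rw [← Real.rpow_add (by positivity), Fin.sum_univ_castSucc, ← add_assoc]
      refine Real.rpow_le_rpow (by positivity) hj' ?_
      positivity
    refine (norm_sum_le_of_le _ hterm).trans ?_
    rw [Finset.sum_const, Finset.card_range, nsmul_eq_mul]
    have : ((k + 1 : ℕ) : ℝ) + ∑ i, ‖s i‖ = 1 + ((k : ℝ) + ∑ i, ‖s i‖) := by push_cast; ring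
    rw [this, Real.rpow_add (by positivity) 1, Real.rpow_one]
    exact mul_le_mul_of_nonneg_right (by linarith) (by positivity)

theorem differentiable_init (k : ℕ) :
    Differentiable ℂ (fun s : Fin (k + 1) → ℂ => (Fin.init s : Fin k → ℂ)) :=
  differentiable_pi.2 fun i => differentiable_apply i.castSucc

theorem differentiable_tail (k : ℕ) :
    Differentiable ℂ (fun s : Fin (k + 1) → ℂ => (Fin.tail s : Fin k → ℂ)) :=
  differentiable_pi.2 fun i => differentiable_apply i.succ

theorem differentiable_one_div_cpow_apply {k : ℕ} (i : Fin k) (j : ℕ) :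
    Differentiable ℂ (fun s : Fin k → ℂ => 1 / ((j + 1 : ℕ) : ℂ) ^ s i) := fun s =>
  DifferentiableAt.comp (g := fun z : ℂ => 1 / ((j + 1 : ℕ) : ℂ) ^ z) s
    (differentiableAt_one_div_natCast_cpow (Nat.succ_pos j) (s i)) (differentiableAt_apply i s)

theorem differentiable_headSum : ∀ (k N : ℕ), Differentiable ℂ (fun s => headSum k s N)
  | 0, _ => by simp only [headSum]; exact differentiable_const _
  | k + 1, N => by
    simp only [headSum_succ]
    exact Differentiable.fun_sum fun j _ =>
      ((differentiable_headSum k j).comp (differentiable_init k)).mul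
        (differentiable_one_div_cpow_apply _ j)

/-- The region in which the summation over the last variable converges absolutely, moved by `K` in
the last coordinate. -/
def lastRegion (k K : ℕ) : Set (Fin (k + 1) → ℂ) :=
  {s | (k : ℝ) + 1 + ∑ i, ‖Fin.init (α := fun _ => ℂ) s i‖ < (s (Fin.last k)).re + K}

theorem continuous_sum_norm_init (k : ℕ) :
    Continuous fun s : Fin (k + 1) → ℂ => ∑ i, ‖Fin.init (α := fun _ => ℂ) s i‖ :=
  continuous_finsetSum _ fun i _ => (continuous_apply i.castSucc).norm

theorem isOpen_lastRegion (k K : ℕ) : IsOpen (lastRegion k K) :=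
  isOpen_lt (continuous_const.add (continuous_sum_norm_init k))
    ((Complex.continuous_re.comp (continuous_apply _)).add continuous_const)

theorem lastRegion_mono (k : ℕ) {K L : ℕ} (h : K ≤ L) : lastRegion k K ⊆ lastRegion k L := by
  intro s hs
  have : (K : ℝ) ≤ L := by exact_mod_cast h
  simp only [lastRegion, Set.mem_ofPred_eq] at hs ⊢
  linarith

theorem re_last_pos {k : ℕ} {s : Fin (k + 1) → ℂ} (hs : s ∈ lastRegion k 0) :
    (k : ℝ) + 1 < (s (Fin.last k)).re := by
  have h : 0 ≤ ∑ i, ‖Fin.init (α := fun _ => ℂ) s i‖ := Finset.sum_nonneg fun i _ => norm_nonneg _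
  simp only [lastRegion, Set.mem_ofPred_eq, Nat.cast_zero, add_zero] at hs
  linarith

/-- Local domination of series of head sums against a kernel that decays like `N ^ (-s)`. -/
theorem headSum_mul_locally_dominated {k : ℕ} {κ : ℕ → ℂ → ℂ} {C : ℝ} (hC : 0 ≤ C)
    (hκ : ∀ N z, 0 ≤ z.re → ‖κ N z‖ ≤ C * 2 ^ z.re * ((N : ℝ) + 1) ^ (-z.re))
    {s : Fin (k + 1) → ℂ} (hs : s ∈ lastRegion k 0) :
    ∃ u : ℕ → ℝ, Summable u ∧ ∃ V ∈ 𝓝 s, V ⊆ lastRegion k 0 ∧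
      ∀ N, ∀ t ∈ V, ‖headSum k (Fin.init t) N * κ N (t (Fin.last k))‖ ≤ u N := by
  have hs' : (k : ℝ) + 1 + ∑ i, ‖Fin.init (α := fun _ => ℂ) s i‖ < (s (Fin.last k)).re := by
    simpa [lastRegion] using hs
  obtain ⟨δ, hδ0, hδ⟩ : ∃ δ > 0,
      (k : ℝ) + 1 + ∑ i, ‖Fin.init (α := fun _ => ℂ) s i‖ + δ < (s (Fin.last k)).re :=
    ⟨((s (Fin.last k)).re - ((k : ℝ) + 1 + ∑ i, ‖Fin.init (α := fun _ => ℂ) s i‖)) / 2,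
      by linarith, by linarith⟩
  -- On the neighbourhood below, `R` bounds the factor `2 ^ z.re`, and the margin `δ` leaves terms
  -- of size at most `(N + 1) ^ (-(1 + δ))`.
  set R := (s (Fin.last k)).re + 1
  refine ⟨fun N => C * 2 ^ R * (1 / ((N + 1 : ℕ) : ℝ) ^ (1 + δ)), ?_,
    {t | (k : ℝ) + 1 + ∑ i, ‖Fin.init (α := fun _ => ℂ) t i‖ + δ < (t (Fin.last k)).re} ∩
      {t | (t (Fin.last k)).re < R}, ?_, ?_, ?_⟩
  · exact ((summable_nat_add_iff 1).2
      (Real.summable_one_div_nat_rpow.2 (by linarith))).mul_left _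
  · have hre : Continuous fun t : Fin (k + 1) → ℂ => (t (Fin.last k)).re :=
      Complex.continuous_re.comp (continuous_apply _)
    refine Filter.inter_mem (IsOpen.mem_nhds (isOpen_lt ((continuous_const.add
      (continuous_sum_norm_init k)).add continuous_const) hre) hδ)
      (IsOpen.mem_nhds (isOpen_lt hre continuous_const) ?_)
    simp [R]
  · rintro t ⟨ht, -⟩
    simp only [lastRegion, Set.mem_ofPred_eq, Nat.cast_zero, add_zero] at ht ⊢
    linarith
  · rintro N t ⟨ht, htR⟩
    simp only [Set.mem_ofPred_eq] at ht htR
    have h0 : 0 ≤ ∑ i, ‖Fin.init (α := fun _ => ℂ) t i‖ :=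
      Finset.sum_nonneg fun i _ => norm_nonneg _
    have hN : (1 : ℝ) ≤ (N : ℝ) + 1 := by linarith [(Nat.cast_nonneg N : (0 : ℝ) ≤ N)]
    have hre0 : 0 ≤ (t (Fin.last k)).re := by
      have : (0 : ℝ) ≤ k := Nat.cast_nonneg k
      linarith
    rw [norm_mul]
    refine (mul_le_mul (norm_headSum_le k _ N) (hκ N _ hre0) (norm_nonneg _)
      (by positivity)).trans ?_
    rw [mul_left_comm, ← Real.rpow_add (by positivity)]
    simp only [one_div]
    rw [← Real.rpow_neg (by positivity)]
    push_cast
    have h2 : (2 : ℝ) ^ (t (Fin.last k)).re ≤ 2 ^ R :=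
      Real.rpow_le_rpow_of_exponent_le (by norm_num) htR.le
    gcongr
    linarith

/-! ### Meromorphic continuation of the Euler-Zagier series -/

/-- Merge the last two variables `a, b` into `a + b - 1`. -/
noncomputable def mergeLast (k : ℕ) (s : Fin (k + 2) → ℂ) : Fin (k + 1) → ℂ :=
  Fin.init s + Pi.single (Fin.last k) (s (Fin.last (k + 1)) - 1)

/-- Add `1` to the last variable. -/
noncomputable def shiftLast (k : ℕ) (s : Fin (k + 1) → ℂ) : Fin (k + 1) → ℂ :=
  s + Pi.single (Fin.last k) 1

theorem init_add_single_last {k : ℕ} (s : Fin (k + 1) → ℂ) (c : ℂ) :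
    Fin.init (α := fun _ => ℂ) (s + Pi.single (Fin.last k) c) = Fin.init s := by
  funext i
  simp [Fin.init, (Fin.castSucc_lt_last i).ne]

@[simp] theorem init_shiftLast {k : ℕ} (s : Fin (k + 1) → ℂ) :
    Fin.init (α := fun _ => ℂ) (shiftLast k s) = Fin.init s := init_add_single_last s 1

@[simp] theorem shiftLast_last {k : ℕ} (s : Fin (k + 1) → ℂ) :
    shiftLast k s (Fin.last k) = s (Fin.last k) + 1 := by simp [shiftLast]

@[simp] theorem init_mergeLast {k : ℕ} (s : Fin (k + 2) → ℂ) :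
    Fin.init (α := fun _ => ℂ) (mergeLast k s) =
      Fin.init (α := fun _ => ℂ) (Fin.init (α := fun _ => ℂ) s) := init_add_single_last _ _

@[simp] theorem mergeLast_last {k : ℕ} (s : Fin (k + 2) → ℂ) :
    mergeLast k s (Fin.last k) = Fin.init (α := fun _ => ℂ) s (Fin.last k) +
      (s (Fin.last (k + 1)) - 1) := by simp [mergeLast]

theorem mergeLast_shiftLast {k : ℕ} (s : Fin (k + 2) → ℂ) :
    mergeLast k (shiftLast (k + 1) s) = shiftLast k (mergeLast k s) := by
  rw [mergeLast, init_shiftLast, shiftLast_last, shiftLast, mergeLast,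
    add_assoc (Fin.init (α := fun _ => ℂ) s),
    ← Pi.single_add, add_sub_right_comm (s (Fin.last (k + 1)))]

theorem differentiable_mergeLast (k : ℕ) : Differentiable ℂ (mergeLast k) := by
  refine differentiable_pi.2 fun i => ?_
  simp only [mergeLast, Pi.add_apply]
  refine (differentiable_apply i.castSucc).add ?_
  rcases eq_or_ne i (Fin.last k) with rfl | h
  · simp only [Pi.single_eq_same]
    exact (differentiable_apply _).sub_const 1
  · simp only [Pi.single_eq_of_ne h]
    exact differentiable_const _

theorem differentiable_shiftLast (k : ℕ) : Differentiable ℂ (shiftLast k) :=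
  differentiable_id.add_const _

theorem shiftLast_mem_lastRegion {k K : ℕ} {s : Fin (k + 1) → ℂ} :
    shiftLast k s ∈ lastRegion k K ↔ s ∈ lastRegion k (K + 1) := by
  simp only [lastRegion, Set.mem_ofPred_eq, init_shiftLast, shiftLast_last, Complex.add_re,
    Complex.one_re, Nat.cast_add, Nat.cast_one]
  rw [add_assoc (s (Fin.last k)).re, add_comm (1 : ℝ) (K : ℝ)]

theorem mergeLast_mem_lastRegion {k : ℕ} {s : Fin (k + 2) → ℂ} (hs : s ∈ lastRegion (k + 1) 0) :
    mergeLast k s ∈ lastRegion k 0 := by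
  simp only [lastRegion, Set.mem_ofPred_eq, init_mergeLast, mergeLast_last, Complex.add_re,
    Complex.sub_re, Complex.one_re] at hs ⊢
  rw [Fin.sum_univ_castSucc] at hs
  have h1 := (abs_le.1 (Complex.abs_re_le_norm (Fin.init (α := fun _ => ℂ) s (Fin.last k)))).1
  have h2 : ∀ i, Fin.init (α := fun _ => ℂ) (Fin.init (α := fun _ => ℂ) s) i =
    Fin.init (α := fun _ => ℂ) s i.castSucc := fun _ => rfl
  simp only [h2]
  push_cast at hs ⊢
  linarith

/-- An entire function that vanishes on the singularities of the Euler-Zagier zeta-function in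
`k + 1` variables. -/
noncomputable def poleDen : (k : ℕ) → (Fin (k + 1) → ℂ) → ℂ
  | 0, s => (Complex.Gamma (s (Fin.last 0) - 1))⁻¹
  | k + 1, s => poleDen k (mergeLast k s) * (Complex.Gamma (s (Fin.last (k + 1)) - 1))⁻¹

theorem differentiable_poleDen : ∀ k : ℕ, Differentiable ℂ (poleDen k)
  | 0 => Complex.differentiable_one_div_Gamma.comp ((differentiable_apply _).sub_const 1)
  | k + 1 => ((differentiable_poleDen k).comp (differentiable_mergeLast k)).mul
      (Complex.differentiable_one_div_Gamma.comp ((differentiable_apply _).sub_const 1))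

theorem inv_Gamma_add_one_ne_zero {z : ℂ} (h : (Complex.Gamma z)⁻¹ ≠ 0) :
    (Complex.Gamma (z + 1))⁻¹ ≠ 0 := by
  have hz : z ≠ 0 := by
    rintro rfl
    simp at h
  rw [Complex.Gamma_add_one z hz, mul_inv]
  exact mul_ne_zero (inv_ne_zero hz) h

/-- The zeros of `1/Γ` are `0, -1, -2, …`, and no shift by `+1` can bring a point outside this set
into it. This is why `poleDen` is built from `1/Γ`: one entire function covers the poles from any
number of continuation steps. -/
theorem poleDen_shiftLast_ne_zero : ∀ {k : ℕ} {s : Fin (k + 1) → ℂ}, poleDen k s ≠ 0 →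
    poleDen k (shiftLast k s) ≠ 0
  | 0, s, h => by
    rw [poleDen] at h ⊢
    rw [shiftLast_last, add_sub_right_comm]
    exact inv_Gamma_add_one_ne_zero h
  | k + 1, s, h => by
    rw [poleDen] at h ⊢
    rw [shiftLast_last, add_sub_right_comm, mergeLast_shiftLast]
    exact mul_ne_zero (poleDen_shiftLast_ne_zero (left_ne_zero_of_mul h))
      (inv_Gamma_add_one_ne_zero (right_ne_zero_of_mul h))

theorem last_ne_one_of_poleDen_ne_zero {k : ℕ} {s : Fin (k + 1) → ℂ} (h : poleDen k s ≠ 0) :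
    s (Fin.last k) ≠ 1 := by
  intro h1
  cases k <;> exact h (by rw [poleDen, h1]; simp)

theorem poleDen_mergeLast_ne_zero {k : ℕ} {s : Fin (k + 2) → ℂ} (h : poleDen (k + 1) s ≠ 0) :
    poleDen k (mergeLast k s) ≠ 0 := left_ne_zero_of_mul h

theorem poleDen_ne_zero_of_mem_halfSpace : ∀ {k : ℕ} {s : Fin (k + 1) → ℂ},
    s ∈ multiZetaHalfSpace (k + 1) → poleDen k s ≠ 0
  | 0, s, h => inv_ne_zero (Complex.Gamma_ne_zero_of_re_pos (by
      have := h (Fin.last 0); simp only [Complex.sub_re, Complex.one_re]; linarith))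
  | k + 1, s, h => mul_ne_zero (poleDen_ne_zero_of_mem_halfSpace (by
        have h1 := h (Fin.last (k + 1))
        intro i
        have h2 : 1 < (s i.castSucc).re := h i.castSucc
        rcases eq_or_ne i (Fin.last k) with rfl | hi
        · rw [mergeLast_last]
          simp only [Fin.init, Complex.add_re, Complex.sub_re, Complex.one_re]
          linarith
        · simpa [mergeLast, Fin.init, hi] using h2))
      (inv_ne_zero (Complex.Gamma_ne_zero_of_re_pos (by
        have := h (Fin.last (k + 1)); simp only [Complex.sub_re, Complex.one_re]; linarith)))

/-! ### Series of head sums against kernels -/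

theorem kern_series_summable {k : ℕ} {p : ℝ → ℝ} (hp : Continuous p) {s : Fin (k + 1) → ℂ}
    (hs : s ∈ lastRegion k 0) :
    Summable fun N => headSum k (Fin.init s) N * kern p (s (Fin.last k)) N := by
  obtain ⟨C, hC, hκ⟩ := norm_kern_le hp
  obtain ⟨u, hu, V, hV, -, hb⟩ :=
    headSum_mul_locally_dominated (κ := fun N z => kern p z N) hC hκ hs
  exact Summable.of_norm_bounded hu fun N => hb N s (mem_of_mem_nhds hV)

theorem lastSeries_summable {k : ℕ} {s : Fin (k + 1) → ℂ} (hs : s ∈ lastRegion k 0) :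
    Summable fun N => headSum k (Fin.init s) N * (1 / ((N + 1 : ℕ) : ℂ) ^ s (Fin.last k)) := by
  have hκ : ∀ (N : ℕ) (z : ℂ), 0 ≤ z.re → ‖1 / ((N + 1 : ℕ) : ℂ) ^ z‖ ≤
      1 * 2 ^ z.re * ((N : ℝ) + 1) ^ (-z.re) := by
    intro N z hz
    rw [norm_one_div_natCast_cpow (Nat.succ_pos N), Real.rpow_neg (by positivity), one_mul, one_div]
    push_cast
    have : (1 : ℝ) ≤ 2 ^ z.re := Real.one_le_rpow (by norm_num) hz
    exact le_mul_of_one_le_left (by positivity) this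
  obtain ⟨u, hu, V, hV, -, hb⟩ :=
    headSum_mul_locally_dominated (κ := fun N z => 1 / ((N + 1 : ℕ) : ℂ) ^ z) zero_le_one hκ hs
  exact Summable.of_norm_bounded hu fun N => hb N s (mem_of_mem_nhds hV)

/-- Abel summation; the boundary term is the one that `tendsto_headSum_mul_cpow` sends to zero. -/
theorem sum_range_sub_mul_sum_range (u b : ℕ → ℂ) (X : ℕ) :
    ∑ N ∈ Finset.range X, (∑ j ∈ Finset.range N, b j) * (u N - u (N + 1)) =
      ∑ j ∈ Finset.range X, b j * u (j + 1) - (∑ j ∈ Finset.range X, b j) * u X := by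
  induction X with
  | zero => simp
  | succ X ih =>
    rw [Finset.sum_range_succ, ih, Finset.sum_range_succ (fun j => b j * u (j + 1)),
      Finset.sum_range_succ b]
    ring

theorem tendsto_headSum_mul_cpow {k : ℕ} {s : Fin (k + 2) → ℂ} (hs : s ∈ lastRegion (k + 1) 0) :
    Tendsto (fun N : ℕ => headSum (k + 1) (Fin.init s) N * (N : ℂ) ^ (1 - s (Fin.last (k + 1))))
      atTop (𝓝 0) := by
  set z := s (Fin.last (k + 1)) with hz
  have hre : 1 ≤ z.re := by
    have := re_last_pos hs
    push_cast at this
    have h0 : (0 : ℝ) ≤ k := Nat.cast_nonneg k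
    linarith
  have hs' : ((k + 1 : ℕ) : ℝ) + 1 + ∑ i, ‖Fin.init (α := fun _ => ℂ) s i‖ < z.re := by
    simpa [lastRegion] using hs
  set e : ℝ := ((k + 1 : ℕ) : ℝ) + ∑ i, ‖Fin.init (α := fun _ => ℂ) s i‖
  have hb : ∀ N : ℕ, ‖headSum (k + 1) (Fin.init s) N * (N : ℂ) ^ (1 - z)‖ ≤
      2 ^ (z.re - 1) * ((N : ℝ) + 1) ^ (-(z.re - 1 - e)) := by
    intro N
    rcases N.eq_zero_or_pos with rfl | hN
    · simp only [headSum_succ_zero, zero_mul, norm_zero]; positivity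
    rw [norm_mul, Complex.norm_natCast_cpow_of_pos hN, Complex.sub_re, Complex.one_re,
      show 1 - z.re = -(z.re - 1) by ring]
    refine (mul_le_mul (norm_headSum_le (k + 1) _ N)
      (rpow_neg_le_two_rpow_mul hN (by linarith)) (by positivity) (by positivity)).trans ?_
    rw [mul_left_comm, ← Real.rpow_add (by positivity)]
    refine le_of_eq ?_
    congr 2
    ring
  refine squeeze_zero_norm hb ?_
  have h1 : Tendsto (fun N : ℕ => ((N : ℝ) + 1) ^ (-(z.re - 1 - e))) atTop (𝓝 0) :=
    (tendsto_rpow_neg_atTop (by simp only [e]; linarith)).comp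
      (tendsto_atTop_add_const_right _ _ tendsto_natCast_atTop_atTop)
  simpa using h1.const_mul (2 ^ (z.re - 1))

theorem last_ne_one_of_mem_lastRegion {k : ℕ} {s : Fin (k + 1) → ℂ} (hs : s ∈ lastRegion k 0) :
    s (Fin.last k) ≠ 1 := by
  intro h
  have := re_last_pos hs
  rw [h, Complex.one_re] at this
  linarith [(Nat.cast_nonneg k : (0 : ℝ) ≤ k)]

/-- Summation over the last variable by telescoping. -/
theorem hasSum_headSum_mul_kern_one {k : ℕ} {s : Fin (k + 2) → ℂ}
    (hs : s ∈ lastRegion (k + 1) 0) :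
    HasSum (fun N => headSum (k + 1) (Fin.init s) N * kern (fun _ => 1) (s (Fin.last (k + 1))) N)
      (lastSeries k (mergeLast k s) / (s (Fin.last (k + 1)) - 1)) := by
  set z := s (Fin.last (k + 1)) with hz
  have hz1 : z ≠ 1 := last_ne_one_of_mem_lastRegion hs
  have hz1' : z - 1 ≠ 0 := sub_ne_zero.2 hz1
  set b : ℕ → ℂ := fun j => headSum k (Fin.init (α := fun _ => ℂ) (Fin.init (α := fun _ => ℂ) s)) j *
    (1 / ((j + 1 : ℕ) : ℂ) ^ Fin.init (α := fun _ => ℂ) s (Fin.last k)) with hb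
  have hterm : ∀ N, headSum (k + 1) (Fin.init s) N * kern (fun _ => 1) z N =
      (∑ j ∈ Finset.range N, b j) *
        ((N : ℂ) ^ (1 - z) - ((N + 1 : ℕ) : ℂ) ^ (1 - z)) / (z - 1) := by
    intro N
    rcases N.eq_zero_or_pos with rfl | hN
    · simp
    · rw [kern_one_eq hz1 hN, headSum_succ, mul_div_assoc]
  -- The factor `(j + 1) ^ (1 - z)` is absorbed into the last exponent of the head sum, which
  -- becomes the sum of the last two variables minus `1`.
  have hu : ∀ j, b j * ((j + 1 : ℕ) : ℂ) ^ (1 - z) =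
      headSum k (Fin.init (mergeLast k s)) j *
        (1 / ((j + 1 : ℕ) : ℂ) ^ (mergeLast k s (Fin.last k))) := by
    intro j
    have h0 : ((j + 1 : ℕ) : ℂ) ≠ 0 := by exact_mod_cast Nat.succ_ne_zero j
    rw [init_mergeLast, mergeLast_last, ← hz, hb, mul_assoc,
      show (1 : ℂ) - z = -(z - 1) by ring, Complex.cpow_neg, Complex.cpow_add _ _ h0, one_div,
      one_div, mul_inv]
  have hsumm := kern_series_summable (p := fun _ => 1) continuous_const hs
  rw [← hz] at hsumm
  refine (hsumm.hasSum_iff_tendsto_nat).2 ?_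
  have h1 := (lastSeries_summable (mergeLast_mem_lastRegion hs)).hasSum.tendsto_sum_nat
  have h2 := (h1.sub (tendsto_headSum_mul_cpow hs)).div_const (z - 1)
  rw [sub_zero] at h2
  refine h2.congr fun X => ?_
  simp only [hterm, ← Finset.sum_div]
  rw [sum_range_sub_mul_sum_range (fun N => (N : ℂ) ^ (1 - z)) b X, headSum_succ]
  simp only [hu]
  rfl

/-- The continuation to `lastRegion (k + 1) K` of the series of head sums against `kern p`, where
`g` continues the Euler-Zagier series in `k + 1` variables. -/
noncomputable def kernCont (k : ℕ) (g : (Fin (k + 1) → ℂ) → ℂ) :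
    ℕ → (ℝ → ℝ) → (Fin (k + 2) → ℂ) → ℂ
  | 0, p, s => ∑' N, headSum (k + 1) (Fin.init s) N * kern p (s (Fin.last (k + 1))) N
  | K + 1, p, s => ((∫ v in (0 : ℝ)..1, p v : ℝ) : ℂ) *
      (g (mergeLast k s) / (s (Fin.last (k + 1)) - 1)) +
        s (Fin.last (k + 1)) * kernCont k g K (meanPrim p) (shiftLast (k + 1) s)

section KernCont

variable {k : ℕ} {g : (Fin (k + 1) → ℂ) → ℂ}

/-- Apply `kern_eq` termwise; the mean part is a multiple of the telescoping series for the kernel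
`1`. -/
theorem kernCont_one_eq_zero (hg : ∀ s ∈ lastRegion k 0, g s = lastSeries k s) {p : ℝ → ℝ}
    (hp : Continuous p) {s : Fin (k + 2) → ℂ} (hs : s ∈ lastRegion (k + 1) 0) :
    kernCont k g 1 p s = kernCont k g 0 p s := by
  have hs' : shiftLast (k + 1) s ∈ lastRegion (k + 1) 0 :=
    shiftLast_mem_lastRegion.2 (lastRegion_mono _ (Nat.zero_le _) hs)
  have h1 := (hasSum_headSum_mul_kern_one hs).mul_left ((∫ v in (0 : ℝ)..1, p v : ℝ) : ℂ)
  have h2 := ((kern_series_summable (continuous_meanPrim hp) hs').hasSum).mul_left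
    (s (Fin.last (k + 1)))
  have h3 := (h1.add h2).tsum_eq
  have hz1 := last_ne_one_of_mem_lastRegion hs
  rw [kernCont, kernCont, kernCont, hg _ (mergeLast_mem_lastRegion hs), ← h3]
  refine tsum_congr fun N => ?_
  rcases N.eq_zero_or_pos with rfl | hN
  · simp
  · rw [kern_eq hp hz1 hN, kern_one_eq hz1 hN, init_shiftLast, shiftLast_last]
    ring

/-- The induction replaces `p` by `meanPrim p` and `s` by its shift, which carries region `K + 1`
into region `K`; hence both are kept general. -/
theorem kernCont_succ (hg : ∀ s ∈ lastRegion k 0, g s = lastSeries k s) :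
    ∀ (K : ℕ) {p : ℝ → ℝ}, Continuous p → ∀ {s : Fin (k + 2) → ℂ},
      s ∈ lastRegion (k + 1) K → kernCont k g (K + 1) p s = kernCont k g K p s
  | 0, _, hp, _, hs => kernCont_one_eq_zero hg hp hs
  | K + 1, p, hp, s, hs => by
    rw [kernCont, kernCont_succ hg K (continuous_meanPrim hp) (shiftLast_mem_lastRegion.2 hs),
      ← kernCont]

theorem kernCont_eq_of_le (hg : ∀ s ∈ lastRegion k 0, g s = lastSeries k s) {K L : ℕ} (h : K ≤ L)
    {p : ℝ → ℝ} (hp : Continuous p) {s : Fin (k + 2) → ℂ} (hs : s ∈ lastRegion (k + 1) K) :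
    kernCont k g L p s = kernCont k g K p s := by
  induction L, h using Nat.le_induction with
  | base => rfl
  | succ L hL ih => rw [kernCont_succ hg L hp (lastRegion_mono _ hL hs), ih]

theorem differentiableOn_kernCont (hg : DifferentiableOn ℂ g {s | poleDen k s ≠ 0}) :
    ∀ (K : ℕ) {p : ℝ → ℝ}, Continuous p → DifferentiableOn ℂ (kernCont k g K p)
      (lastRegion (k + 1) K ∩ {s | poleDen (k + 1) s ≠ 0})
  | 0, p, hp => by
    refine DifferentiableOn.mono ?_ Set.inter_subset_left
    refine differentiableOn_tsum_of_locally_summable (fun N => Differentiable.differentiableOn ?_)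
      fun s hs => ?_
    · exact ((differentiable_headSum (k + 1) N).comp (differentiable_init _)).mul
        ((differentiable_kern hp N).comp (differentiable_apply _))
    · obtain ⟨C, hC, hκ⟩ := norm_kern_le hp
      exact headSum_mul_locally_dominated (κ := fun N z => kern p z N) hC hκ hs
  | K + 1, p, hp => by
    have h1 : DifferentiableOn ℂ (fun s : Fin (k + 2) → ℂ => g (mergeLast k s))
        (lastRegion (k + 1) (K + 1) ∩ {s | poleDen (k + 1) s ≠ 0}) :=
      hg.comp (differentiable_mergeLast k).differentiableOn
        fun s hs => poleDen_mergeLast_ne_zero hs.2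
    have h2 : DifferentiableOn ℂ
        (fun s : Fin (k + 2) → ℂ => kernCont k g K (meanPrim p) (shiftLast (k + 1) s))
        (lastRegion (k + 1) (K + 1) ∩ {s | poleDen (k + 1) s ≠ 0}) :=
      (differentiableOn_kernCont hg K (continuous_meanPrim hp)).comp
        (differentiable_shiftLast (k + 1)).differentiableOn
        fun s hs => ⟨shiftLast_mem_lastRegion.2 hs.1, poleDen_shiftLast_ne_zero hs.2⟩
    have h3 : Differentiable ℂ fun s : Fin (k + 2) → ℂ => s (Fin.last (k + 1)) :=
      differentiable_apply _
    have h5 : ∀ s ∈ lastRegion (k + 1) (K + 1) ∩ {s | poleDen (k + 1) s ≠ 0},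
        s (Fin.last (k + 1)) - 1 ≠ 0 := fun s hs =>
      sub_ne_zero.2 (last_ne_one_of_poleDen_ne_zero hs.2)
    have h4 := h1.fun_mul ((h3.sub_const 1).differentiableOn.fun_inv h5)
    simp only [← div_eq_mul_inv] at h4
    exact (h4.const_mul _).add (h3.differentiableOn.mul h2)

theorem lastSeries_succ_eq {s : Fin (k + 2) → ℂ} (hs : s ∈ lastRegion (k + 1) 0) :
    lastSeries (k + 1) s = lastSeries k (mergeLast k s) / (s (Fin.last (k + 1)) - 1) -
      s (Fin.last (k + 1)) * kernCont k g 0 id (shiftLast (k + 1) s) := by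
  have hs' : shiftLast (k + 1) s ∈ lastRegion (k + 1) 0 :=
    shiftLast_mem_lastRegion.2 (lastRegion_mono _ (Nat.zero_le _) hs)
  have h2 := ((kern_series_summable continuous_id hs').hasSum).mul_left (s (Fin.last (k + 1)))
  rw [kernCont, ← ((hasSum_headSum_mul_kern_one hs).sub h2).tsum_eq, lastSeries]
  refine tsum_congr fun N => ?_
  rcases N.eq_zero_or_pos with rfl | hN
  · simp
  · rw [one_div_cpow_eq_kern hN, init_shiftLast, shiftLast_last]
    ring

end KernCont

theorem exists_mem_lastRegion (k : ℕ) (s : Fin (k + 1) → ℂ) : ∃ K, s ∈ lastRegion k K := by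
  obtain ⟨K, hK⟩ := exists_nat_gt
    ((k : ℝ) + 1 + ∑ i, ‖Fin.init (α := fun _ => ℂ) s i‖ - (s (Fin.last k)).re)
  exact ⟨K, by simp only [lastRegion, Set.mem_ofPred_eq]; linarith⟩

/-- Induction on the number of variables, starting from the Riemann zeta-function. The step extends
the identity `lastSeries_succ_eq`, both of whose terms are already continued. -/
theorem exists_lastSeries_continuation : ∀ k : ℕ, ∃ g : (Fin (k + 1) → ℂ) → ℂ,
    DifferentiableOn ℂ g {s | poleDen k s ≠ 0} ∧ ∀ s ∈ lastRegion k 0, g s = lastSeries k s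
  | 0 => by
    refine ⟨fun s => riemannZeta (s (Fin.last 0)), fun s hs => ?_, fun s hs => ?_⟩
    · exact (DifferentiableAt.comp (g := riemannZeta) s
        (differentiableAt_riemannZeta (last_ne_one_of_poleDen_ne_zero hs))
        (differentiableAt_apply (𝕜 := ℂ) (Fin.last 0) s)).differentiableWithinAt
    · have h := re_last_pos hs
      simp only
      rw [zeta_eq_tsum_one_div_nat_add_one_cpow (by simpa using h), lastSeries]
      simp [headSum]
  | k + 1 => by
    obtain ⟨g, hg, hgs⟩ := exists_lastSeries_continuation k
    choose K hK using exists_mem_lastRegion (k + 1)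
    -- The stage `K s` depends on the point, but any stage whose region contains the point gives the
    -- same value; so near each point `A` is a single holomorphic stage.
    set A : (Fin (k + 2) → ℂ) → ℂ := fun s => kernCont k g (K s) id s with hA
    have hAeq : ∀ (L : ℕ) (s : Fin (k + 2) → ℂ), s ∈ lastRegion (k + 1) L →
        A s = kernCont k g L id s := by
      intro L s hs
      rw [hA]
      rcases le_total (K s) L with h | h
      · exact (kernCont_eq_of_le hgs h continuous_id (hK s)).symm
      · exact kernCont_eq_of_le hgs h continuous_id hs
    have hG : IsOpen {s : Fin (k + 2) → ℂ | poleDen (k + 1) s ≠ 0} :=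
      isOpen_ne_fun (differentiable_poleDen _).continuous continuous_const
    have hAd : DifferentiableOn ℂ A {s | poleDen (k + 1) s ≠ 0} := by
      intro s hs
      have hU := (isOpen_lastRegion (k + 1) (K s)).inter hG
      have h1 := (differentiableOn_kernCont hg (K s) continuous_id).differentiableAt
        (hU.mem_nhds ⟨hK s, hs⟩)
      refine (h1.congr_of_eventuallyEq ?_).differentiableWithinAt
      filter_upwards [hU.mem_nhds ⟨hK s, hs⟩] with t ht using hAeq _ t ht.1
    refine ⟨fun s => g (mergeLast k s) / (s (Fin.last (k + 1)) - 1) -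
      s (Fin.last (k + 1)) * A (shiftLast (k + 1) s), ?_, fun s hs => ?_⟩
    · have h1 : DifferentiableOn ℂ (fun s : Fin (k + 2) → ℂ => g (mergeLast k s))
          {s | poleDen (k + 1) s ≠ 0} :=
        hg.comp (differentiable_mergeLast k).differentiableOn
          fun s hs => poleDen_mergeLast_ne_zero hs
      have h2 : DifferentiableOn ℂ (fun s : Fin (k + 2) → ℂ => A (shiftLast (k + 1) s))
          {s | poleDen (k + 1) s ≠ 0} :=
        hAd.comp (differentiable_shiftLast (k + 1)).differentiableOn
          fun s hs => poleDen_shiftLast_ne_zero hs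
      have h3 : Differentiable ℂ fun s : Fin (k + 2) → ℂ => s (Fin.last (k + 1)) :=
        differentiable_apply _
      have h5 : ∀ s ∈ {s : Fin (k + 2) → ℂ | poleDen (k + 1) s ≠ 0},
          s (Fin.last (k + 1)) - 1 ≠ 0 := fun s hs =>
        sub_ne_zero.2 (last_ne_one_of_poleDen_ne_zero hs)
      have h4 := h1.fun_mul ((h3.sub_const 1).differentiableOn.fun_inv h5)
      simp only [← div_eq_mul_inv] at h4
      exact h4.sub (h3.differentiableOn.mul h2)
    · simp only
      rw [lastSeries_succ_eq (g := g) hs, hgs _ (mergeLast_mem_lastRegion hs),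
        hAeq 0 _ (shiftLast_mem_lastRegion.2 (lastRegion_mono _ (Nat.zero_le _) hs))]

/-- The Euler-Zagier series continues holomorphically to the complement of the zero set of
`poleDen`. -/
theorem exists_multiZeta_continuation (k : ℕ) : ∃ g : (Fin (k + 1) → ℂ) → ℂ,
    IsMultiZetaContinuation (k + 1) {s | poleDen k s ≠ 0} g := by
  obtain ⟨g, hg, hgs⟩ := exists_lastSeries_continuation k
  have hsub : multiZetaHalfSpace (k + 1) ⊆ {s | poleDen k s ≠ 0} := fun s hs =>
    poleDen_ne_zero_of_mem_halfSpace hs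
  refine ⟨g, isOpen_ne_fun (differentiable_poleDen _).continuous continuous_const,
    isPreconnected_of_ne_zero_subset (differentiable_poleDen k)
      (hsub (two_mem_multiZetaHalfSpace (k + 1))) subset_rfl, hsub, hg, ?_⟩
  -- A point common to the half-space and `lastRegion k 0`, where `g` is known to be the series. The
  -- threshold for the last coordinate there is `k + 1 + 2k`.
  set a : Fin (k + 1) → ℂ := Fin.snoc (fun _ => 2) (((k : ℝ) + 2 + k * 2 : ℝ) : ℂ) with ha
  have hk : (0 : ℝ) ≤ k := Nat.cast_nonneg k
  have ha1 : a ∈ multiZetaHalfSpace (k + 1) := by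
    intro i
    induction i using Fin.lastCases with
    | last => rw [ha, Fin.snoc_last, Complex.ofReal_re]; linarith
    | cast i => simp [ha]
  have ha2 : a ∈ lastRegion k 0 := by
    simp only [lastRegion, Set.mem_ofPred_eq, ha, Fin.init_snoc, Fin.snoc_last, Complex.ofReal_re]
    simp
  refine fun s hs => eqOn_of_isPreconnected (isOpen_multiZetaHalfSpace (k + 1))
    (convex_multiZetaHalfSpace (k + 1)).isPreconnected (hg.mono hsub)
    (differentiableOn_multiZetaSeries (k + 1)) ha1 ?_ s hs
  filter_upwards [(isOpen_multiZetaHalfSpace (k + 1)).mem_nhds ha1,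
    (isOpen_lastRegion k 0).mem_nhds ha2] with t ht1 ht2
  rw [hgs t ht2, multiZetaSeries_eq_lastSeries ht1]

/-! ### The multiple zeta-function is well defined -/

/-- The intersection of the two domains need not be connected. Instead, each function agrees with
the global continuation `g` off the zeros of `poleDen`, and density with continuity covers the
remaining points. -/
theorem IsMultiZetaContinuation.eqOn_inter {k : ℕ} {U V : Set (Fin (k + 1) → ℂ)}
    {f f' : (Fin (k + 1) → ℂ) → ℂ} (hf : IsMultiZetaContinuation (k + 1) U f)
    (hf' : IsMultiZetaContinuation (k + 1) V f') {s : Fin (k + 1) → ℂ} (hs : s ∈ U) (hs' : s ∈ V) :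
    f s = f' s := by
  obtain ⟨g, hg⟩ := exists_multiZeta_continuation k
  have h2 := two_mem_multiZetaHalfSpace (k + 1)
  have key : ∀ {U : Set (Fin (k + 1) → ℂ)} {f : (Fin (k + 1) → ℂ) → ℂ},
      IsMultiZetaContinuation (k + 1) U f → ∀ x ∈ U, poleDen k x ≠ 0 → f x = g x := by
    intro U f hf
    refine eqOn_of_isPreconnected_of_ne_zero hf.isOpen hf.isPreconnected (differentiable_poleDen k)
      hf.differentiableOn hg.differentiableOn (hf.halfSpace_subset h2)
      (poleDen_ne_zero_of_mem_halfSpace h2) ?_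
    filter_upwards [(isOpen_multiZetaHalfSpace (k + 1)).mem_nhds h2] with x hx
    rw [hf.eqOn hx, hg.eqOn hx]
  have hdense := dense_ne_zero (differentiable_poleDen k) (poleDen_ne_zero_of_mem_halfSpace h2)
  have hne : (𝓝[{x | poleDen k x ≠ 0}] s).NeBot := mem_closure_iff_nhdsWithin_neBot.1 (hdense s)
  have hc := (hf.differentiableOn.differentiableAt (hf.isOpen.mem_nhds hs)).continuousAt
  have hc' := (hf'.differentiableOn.differentiableAt (hf'.isOpen.mem_nhds hs')).continuousAt
  refine tendsto_nhds_unique (l := 𝓝[{x | poleDen k x ≠ 0}] s) (hc.tendsto.mono_left nhdsWithin_le_nhds)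
    ((hc'.tendsto.mono_left nhdsWithin_le_nhds).congr' ?_)
  filter_upwards [self_mem_nhdsWithin, mem_nhdsWithin_of_mem_nhds (hf.isOpen.mem_nhds hs),
    mem_nhdsWithin_of_mem_nhds (hf'.isOpen.mem_nhds hs')] with x hx hxU hxV
  rw [key hf x hxU hx, key hf' x hxV hx]

theorem IsMultiZetaContinuation.multiZeta_eq {k : ℕ} {U : Set (Fin (k + 1) → ℂ)}
    {f : (Fin (k + 1) → ℂ) → ℂ} (hf : IsMultiZetaContinuation (k + 1) U f) {s : Fin (k + 1) → ℂ}
    (hs : s ∈ U) : multiZeta (k + 1) s = f s := by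
  have h : ∃ (w : ℂ) (U : Set (Fin (k + 1) → ℂ)) (f : (Fin (k + 1) → ℂ) → ℂ),
      IsMultiZetaContinuation (k + 1) U f ∧ s ∈ U ∧ f s = w := ⟨_, U, f, hf, hs, rfl⟩
  rw [multiZeta, dif_pos h]
  obtain ⟨V, f', hf', hs', hw⟩ := h.choose_spec
  rw [← hw]
  exact hf'.eqOn_inter hf hs' hs

theorem IsMultiZetaContinuation.subset_regular {r : ℕ} {U : Set (Fin r → ℂ)}
    {f : (Fin r → ℂ) → ℂ} (hf : IsMultiZetaContinuation r U f) : U ⊆ multiZetaRegular r :=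
  fun _ hs => ⟨U, f, hf, hs⟩

theorem isOpen_multiZetaRegular (r : ℕ) : IsOpen (multiZetaRegular r) := by
  refine isOpen_iff_mem_nhds.2 fun s hs => ?_
  obtain ⟨U, f, hf, hsU⟩ := hs
  exact mem_of_superset (hf.isOpen.mem_nhds hsU) hf.subset_regular

theorem differentiableOn_multiZeta (k : ℕ) :
    DifferentiableOn ℂ (multiZeta (k + 1)) (multiZetaRegular (k + 1)) := by
  rintro s ⟨U, f, hf, hsU⟩
  refine ((hf.differentiableOn.differentiableAt (hf.isOpen.mem_nhds hsU)).congr_of_eventuallyEq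
    ?_).differentiableWithinAt
  filter_upwards [hf.isOpen.mem_nhds hsU] with t ht using hf.multiZeta_eq ht

theorem mem_regular_of_poleDen_ne_zero {k : ℕ} {s : Fin (k + 1) → ℂ} (hs : poleDen k s ≠ 0) :
    s ∈ multiZetaRegular (k + 1) :=
  (exists_multiZeta_continuation k).choose_spec.subset_regular hs

theorem halfSpace_subset_regular (k : ℕ) :
    multiZetaHalfSpace (k + 1) ⊆ multiZetaRegular (k + 1) := fun _ hs =>
  mem_regular_of_poleDen_ne_zero (poleDen_ne_zero_of_mem_halfSpace hs)

theorem multiZeta_eq_series {k : ℕ} {s : Fin (k + 1) → ℂ} (hs : s ∈ multiZetaHalfSpace (k + 1)) :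
    multiZeta (k + 1) s = multiZetaSeries (k + 1) s := by
  obtain ⟨g, hg⟩ := exists_multiZeta_continuation k
  rw [hg.multiZeta_eq (hg.halfSpace_subset hs), hg.eqOn hs]

/-! ### The common domain of the functions of the last variables -/

theorem differentiable_lastVars {n : ℕ} (j : ℕ) (hj : j ≤ n) :
    Differentiable ℂ (fun s : Fin n → ℂ => lastVars j hj s) :=
  differentiable_pi.2 fun _ => differentiable_apply _

theorem lastVars_mem_halfSpace {n : ℕ} (j : ℕ) (hj : j ≤ n) {s : Fin n → ℂ}
    (hs : s ∈ multiZetaHalfSpace n) : lastVars j hj s ∈ multiZetaHalfSpace j := fun _ => hs _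

theorem isOpen_tailRegular (n : ℕ) : IsOpen (tailRegular n) := by
  simp only [tailRegular, Set.ofPred_forall]
  exact isOpen_iInter_of_finite fun j =>
    (isOpen_multiZetaRegular _).preimage (differentiable_lastVars _ _).continuous

theorem halfSpace_subset_tailRegular (n : ℕ) : multiZetaHalfSpace n ⊆ tailRegular n := fun _ hs _ =>
  halfSpace_subset_regular _ (lastVars_mem_halfSpace _ _ hs)

/-- The set contains the complement of the zeros of one entire function, the product of all the
`poleDen` of the last variables. -/
theorem isPreconnected_tailRegular (n : ℕ) : IsPreconnected (tailRegular n) := by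
  refine isPreconnected_of_ne_zero_subset
    (P := fun s => ∏ j : Fin n, poleDen j (lastVars (j + 1) j.2 s)) (a := fun _ => 2) ?_ ?_ ?_
  · intro s
    exact differentiableAt_finsetProd _ fun j _ =>
      (differentiable_poleDen j).comp (differentiable_lastVars (j + 1) j.2) s
  · exact Finset.prod_ne_zero_iff.2 fun j _ => poleDen_ne_zero_of_mem_halfSpace
      (lastVars_mem_halfSpace _ _ (two_mem_multiZetaHalfSpace n))
  · intro s hs j
    exact mem_regular_of_poleDen_ne_zero (Finset.prod_ne_zero_iff.1 hs j (Finset.mem_univ j))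

theorem lastVars_self {n : ℕ} (s : Fin n → ℂ) : lastVars n le_rfl s = s := by
  funext i
  simp [lastVars]

theorem lastVars_eq_tail {n j : ℕ} (hj : j ≤ n) (hj' : j ≤ n + 1) (s : Fin (n + 1) → ℂ) :
    lastVars j hj' s = lastVars j hj (Fin.tail s) := by
  funext i
  simp only [lastVars, Fin.tail]
  congr 1
  ext
  simp only [Fin.val_succ]
  omega

theorem mem_tailRegular_succ {n : ℕ} {s : Fin (n + 1) → ℂ} :
    s ∈ tailRegular (n + 1) ↔ s ∈ multiZetaRegular (n + 1) ∧ Fin.tail s ∈ tailRegular n := by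
  constructor
  · refine fun h => ⟨?_, fun j => ?_⟩
    · have := h (Fin.last n)
      simp only [Fin.val_last] at this
      rwa [lastVars_self] at this
    · have := h j.castSucc
      simp only [Fin.val_castSucc] at this
      rwa [lastVars_eq_tail j.2] at this
  · rintro ⟨h1, h2⟩ j
    induction j using Fin.lastCases with
    | last =>
      simp only [Fin.val_last]
      rwa [lastVars_self]
    | cast j =>
      simp only [Fin.val_castSucc]
      rw [lastVars_eq_tail j.2]
      exact h2 j

/-- The continuation of the sum of `1 / (n_1 ^ s_1 ⋯ n_k ^ s_k)` over `N < n_1 < ⋯ < n_k`. -/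
noncomputable def tailZeta : (k : ℕ) → ℕ → (Fin k → ℂ) → ℂ
  | 0, _, _ => 1
  | k + 1, N, s => multiZeta (k + 1) s -
      ∑ j ∈ Finset.range N, 1 / ((j + 1 : ℕ) : ℂ) ^ s 0 * tailZeta k (j + 1) (Fin.tail s)

theorem tailZeta_eq_incSum : ∀ (k N : ℕ) {s : Fin k → ℂ}, s ∈ multiZetaHalfSpace k →
    tailZeta k N s = incSum k (fun x => N < x) s
  | 0, N, s, _ => by simp [tailZeta]
  | k + 1, N, s, hs => by
    rw [tailZeta, incSum_gt_eq_sub N hs, multiZeta_eq_series hs]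
    congr 1
    refine Finset.sum_congr rfl fun j _ => ?_
    rw [tailZeta_eq_incSum k (j + 1) (Fin.tail_mem_multiZetaHalfSpace hs)]

theorem differentiableOn_tailZeta : ∀ k N : ℕ, DifferentiableOn ℂ (tailZeta k N) (tailRegular k)
  | 0, N => by
    have : tailZeta 0 N = fun _ => 1 := by funext s; rfl
    rw [this]
    exact differentiableOn_const _
  | k + 1, N => by
    refine DifferentiableOn.sub ((differentiableOn_multiZeta k).mono
      fun s hs => (mem_tailRegular_succ.1 hs).1) (DifferentiableOn.fun_sum fun j _ => ?_)
    exact (differentiable_one_div_cpow_apply 0 j).differentiableOn.mul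
      ((differentiableOn_tailZeta k (j + 1)).comp (differentiable_tail k).differentiableOn
        fun s hs => (mem_tailRegular_succ.1 hs).2)

/-- For `N = 1` the recursion of `tailZeta` subtracts a single term, with coefficient `1 ^ (-s 0) =
1`; iterating it gives the alternating signs. -/
theorem tailF_eq_tailZeta : ∀ (n : ℕ) (s : Fin n → ℂ), tailF n s = tailZeta n 1 s
  | 0, s => by simp [tailF, tailZeta]
  | n + 1, s => by
    have ih := tailF_eq_tailZeta n (Fin.tail s)
    rw [tailZeta, Finset.sum_range_one, ← ih, tailF, tailF, Fin.sum_univ_castSucc]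
    have h1 : ∀ j : Fin n, (-1 : ℂ) ^ (n + 1 + 1 - ((j.castSucc : ℕ) + 1) + 1) *
        multiZeta ((j.castSucc : ℕ) + 1) (lastVars (j.castSucc + 1) j.castSucc.2 s) =
        -((-1 : ℂ) ^ (n + 1 - ((j : ℕ) + 1) + 1) *
          multiZeta (j + 1) (lastVars (j + 1) j.2 (Fin.tail s))) := by
      intro j
      simp only [Fin.val_castSucc]
      rw [lastVars_eq_tail j.2, show n + 1 + 1 - ((j : ℕ) + 1) + 1 =
        (n + 1 - ((j : ℕ) + 1) + 1) + 1 by have := j.2; omega, pow_succ]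
      ring
    have h2 : (-1 : ℂ) ^ (n + 1 + 1 - (((Fin.last n : Fin (n + 1)) : ℕ) + 1) + 1) = 1 := by
      rw [Fin.val_last, show n + 1 + 1 - (n + 1) + 1 = 2 by omega]
      norm_num
    simp only [h1, h2, Finset.sum_neg_distrib]
    simp only [Fin.val_last]
    rw [lastVars_self, pow_succ (-1 : ℂ) (n + 1)]
    simp
    ring

/-- Polynomial growth of the tails, locally uniformly in `s`. -/
theorem norm_tailZeta_le : ∀ (k : ℕ) {s : Fin k → ℂ}, s ∈ tailRegular k →
    ∃ C : ℝ, 0 ≤ C ∧ ∀ᶠ t in 𝓝 s, ∀ N : ℕ,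
      ‖tailZeta k N t‖ ≤ C * ((N : ℝ) + 1) ^ ((k : ℝ) + ∑ i, ‖t i‖)
  | 0, s, _ => ⟨1, zero_le_one, Eventually.of_forall fun t N => by simp [tailZeta]⟩
  | k + 1, s, hs => by
    obtain ⟨hs1, hs2⟩ := mem_tailRegular_succ.1 hs
    obtain ⟨C, hC, hev⟩ := norm_tailZeta_le k hs2
    have hcont := ((differentiableOn_multiZeta k).differentiableAt
      ((isOpen_multiZetaRegular _).mem_nhds hs1)).continuousAt.norm
    have hlt : ∀ᶠ t in 𝓝 s, ‖multiZeta (k + 1) t‖ < ‖multiZeta (k + 1) s‖ + 1 :=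
      hcont.eventually_lt_const (by linarith)
    have hev' := ((differentiable_tail k).continuous.tendsto s).eventually hev
    refine ⟨‖multiZeta (k + 1) s‖ + 1 + C, by positivity, ?_⟩
    filter_upwards [hlt, hev'] with t ht1 ht2 N
    have hN1 : (1 : ℝ) ≤ (N : ℝ) + 1 := by linarith [(Nat.cast_nonneg N : (0 : ℝ) ≤ N)]
    set e : ℝ := (k : ℝ) + ∑ i, ‖t i‖ with he
    have he0 : 0 ≤ e := by positivity
    have hterm : ∀ j ∈ Finset.range N, ‖1 / ((j + 1 : ℕ) : ℂ) ^ t 0 *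
        tailZeta k (j + 1) (Fin.tail t)‖ ≤ C * ((N : ℝ) + 1) ^ e := by
      intro j hj
      have hj' : (j : ℝ) + 1 ≤ N := by exact_mod_cast Finset.mem_range.1 hj
      have hj0 : (0 : ℝ) ≤ j := Nat.cast_nonneg j
      rw [norm_mul]
      have h1 : ‖1 / ((j + 1 : ℕ) : ℂ) ^ t 0‖ ≤ ((N : ℝ) + 1) ^ ‖t 0‖ :=
        (norm_one_div_cpow_le j _).trans
          (Real.rpow_le_rpow (by positivity) (by linarith) (norm_nonneg _))
      have h2 : ‖tailZeta k (j + 1) (Fin.tail t)‖ ≤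
          C * ((N : ℝ) + 1) ^ ((k : ℝ) + ∑ i, ‖Fin.tail (α := fun _ => ℂ) t i‖) := by
        refine (ht2 (j + 1)).trans (mul_le_mul_of_nonneg_left ?_ hC)
        refine Real.rpow_le_rpow (by positivity) (by push_cast; linarith) (by positivity)
      refine (mul_le_mul h1 h2 (norm_nonneg _) (by positivity)).trans (le_of_eq ?_)
      rw [mul_left_comm, ← Real.rpow_add (by positivity), he, Fin.sum_univ_succ]
      congr 2
      simp only [Fin.tail]
      ring
    rw [tailZeta]
    refine (norm_sub_le _ _).trans ?_
    have hsum := norm_sum_le_of_le _ hterm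
    rw [Finset.sum_const, Finset.card_range, nsmul_eq_mul] at hsum
    have hpow : ((N : ℝ) + 1) ^ (((k + 1 : ℕ) : ℝ) + ∑ i, ‖t i‖) =
        ((N : ℝ) + 1) * ((N : ℝ) + 1) ^ e := by
      rw [show ((k + 1 : ℕ) : ℝ) + ∑ i, ‖t i‖ = 1 + e by rw [he]; push_cast; ring,
        Real.rpow_add (by positivity) 1, Real.rpow_one]
    have hbig : 1 ≤ ((N : ℝ) + 1) ^ e := Real.one_le_rpow hN1 he0
    rw [hpow]
    have h3 : ‖multiZeta (k + 1) s‖ + 1 ≤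
        (‖multiZeta (k + 1) s‖ + 1) * (((N : ℝ) + 1) * ((N : ℝ) + 1) ^ e) :=
      le_mul_of_one_le_right (by positivity) (one_le_mul_of_one_le_of_one_le hN1 hbig)
    have h4 : (N : ℝ) * (C * ((N : ℝ) + 1) ^ e) ≤ C * (((N : ℝ) + 1) * ((N : ℝ) + 1) ^ e) := by
      have : 0 ≤ C * ((N : ℝ) + 1) ^ e := by positivity
      nlinarith
    rw [add_mul]
    linarith

/-! ### Summation over the first variable -/

/-- The region in which the summation over the first variable converges. -/
def firstRegion (n : ℕ) : Set (Fin (n + 1) → ℂ) :=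
  {s | Fin.tail s ∈ tailRegular n ∧
    (n : ℝ) + 1 + ∑ i, ‖Fin.tail (α := fun _ => ℂ) s i‖ < (s 0).re}

/-- The Euler-Zagier zeta-function as a Dirichlet series in the first variable. -/
noncomputable def firstSeries (n : ℕ) (s : Fin (n + 1) → ℂ) : ℂ :=
  ∑' j : ℕ, 1 / ((j + 1 : ℕ) : ℂ) ^ s 0 * tailZeta n (j + 1) (Fin.tail s)

theorem continuous_sum_norm (n : ℕ) : Continuous fun s : Fin n → ℂ => ∑ i, ‖s i‖ :=
  continuous_finsetSum _ fun i _ => (continuous_apply i).norm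

theorem isOpen_firstRegion (n : ℕ) : IsOpen (firstRegion n) := by
  have ht := (differentiable_tail n).continuous
  exact ((isOpen_tailRegular n).preimage ht).inter (isOpen_lt
    (continuous_const.add ((continuous_sum_norm n).comp ht))
    (Complex.continuous_re.comp (continuous_apply 0)))

theorem isPreconnected_firstRegion (n : ℕ) : IsPreconnected (firstRegion n) := by
  -- A shear by the convergence abscissa, so that the region is the image of a product of two
  -- connected sets.
  set ψ : ℂ × (Fin n → ℂ) → (Fin (n + 1) → ℂ) := fun x =>
    Fin.cons (x.1 + (((n : ℝ) + 1 + ∑ i, ‖x.2 i‖ : ℝ) : ℂ)) x.2 with hψ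
  have hc : Continuous ψ := by
    refine continuous_pi fun i => ?_
    induction i using Fin.cases with
    | zero =>
      simp only [hψ, Fin.cons_zero]
      exact continuous_fst.add (Complex.continuous_ofReal.comp
        (continuous_const.add ((continuous_sum_norm n).comp continuous_snd)))
    | succ i =>
      simp only [hψ, Fin.cons_succ]
      exact (continuous_apply i).comp continuous_snd
  have himg : firstRegion n = ψ '' ({z : ℂ | 0 < z.re} ×ˢ tailRegular n) := by
    ext s
    constructor
    · rintro ⟨h1, h2⟩
      refine ⟨(s 0 - (((n : ℝ) + 1 + ∑ i, ‖Fin.tail (α := fun _ => ℂ) s i‖ : ℝ) : ℂ), Fin.tail s),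
        ⟨?_, h1⟩, ?_⟩
      · simp only [Set.mem_ofPred_eq, Complex.sub_re, Complex.ofReal_re]
        linarith
      · simp only [hψ, sub_add_cancel]
        exact Fin.cons_self_tail s
    · rintro ⟨⟨z, t⟩, ⟨hz, ht⟩, rfl⟩
      simp only [Set.mem_ofPred_eq] at hz
      refine ⟨by simpa [hψ] using ht, ?_⟩
      simp only [hψ, Fin.tail_cons, Fin.cons_zero, Complex.add_re, Complex.ofReal_re]
      linarith
  rw [himg]
  exact ((convex_halfSpace_re_gt 0).isPreconnected.prod (isPreconnected_tailRegular n)).image _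
    hc.continuousOn

theorem norm_firstSeries_term_le {C e : ℝ} {n : ℕ} (hC : 0 ≤ C) (he : 0 ≤ e)
    {t : Fin (n + 1) → ℂ}
    (ht : ∀ N : ℕ, ‖tailZeta n N (Fin.tail t)‖ ≤ C * ((N : ℝ) + 1) ^ e) (j : ℕ) :
    ‖1 / ((j + 1 : ℕ) : ℂ) ^ t 0 * tailZeta n (j + 1) (Fin.tail t)‖ ≤
      C * 2 ^ e * ((j : ℝ) + 1) ^ (e - (t 0).re) := by
  have hj : (0 : ℝ) ≤ j := Nat.cast_nonneg j
  rw [norm_mul, norm_one_div_natCast_cpow (Nat.succ_pos j), one_div, ← Real.rpow_neg (by positivity)]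
  have h1 : ‖tailZeta n (j + 1) (Fin.tail t)‖ ≤ C * (2 ^ e * ((j : ℝ) + 1) ^ e) := by
    refine (ht (j + 1)).trans (mul_le_mul_of_nonneg_left ?_ hC)
    rw [← Real.mul_rpow (by norm_num) (by positivity)]
    exact Real.rpow_le_rpow (by positivity) (by push_cast; linarith) he
  refine (mul_le_mul_of_nonneg_left h1 (by positivity)).trans (le_of_eq ?_)
  push_cast
  rw [sub_eq_add_neg, Real.rpow_add (by positivity)]
  ring

theorem firstSeries_locally_dominated {n : ℕ} {s : Fin (n + 1) → ℂ} (hs : s ∈ firstRegion n) :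
    ∃ u : ℕ → ℝ, Summable u ∧ ∃ V ∈ 𝓝 s, V ⊆ firstRegion n ∧
      ∀ j, ∀ t ∈ V, ‖1 / ((j + 1 : ℕ) : ℂ) ^ t 0 * tailZeta n (j + 1) (Fin.tail t)‖ ≤ u j := by
  obtain ⟨C, hC, hev⟩ := norm_tailZeta_le n hs.1
  have htc := (differentiable_tail n).continuous
  have hev' := (htc.tendsto s).eventually hev
  obtain ⟨δ, hδ0, hδ⟩ : ∃ δ > 0,
      (n : ℝ) + 1 + ∑ i, ‖Fin.tail (α := fun _ => ℂ) s i‖ + δ < (s 0).re :=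
    ⟨((s 0).re - ((n : ℝ) + 1 + ∑ i, ‖Fin.tail (α := fun _ => ℂ) s i‖)) / 2,
      by linarith [hs.2], by linarith [hs.2]⟩
  set R := (n : ℝ) + ∑ i, ‖Fin.tail (α := fun _ => ℂ) s i‖ + 1 with hR
  have hsc : Continuous fun t : Fin (n + 1) → ℂ => ∑ i, ‖Fin.tail (α := fun _ => ℂ) t i‖ :=
    (continuous_sum_norm n).comp htc
  have hrec : Continuous fun t : Fin (n + 1) → ℂ => (t 0).re :=
    Complex.continuous_re.comp (continuous_apply 0)
  have h1 : ∀ᶠ t in 𝓝 s, (n : ℝ) + 1 + ∑ i, ‖Fin.tail (α := fun _ => ℂ) t i‖ + δ < (t 0).re :=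
    (isOpen_lt ((continuous_const.add hsc).add continuous_const) hrec).mem_nhds hδ
  have h2 : ∀ᶠ t in 𝓝 s, (n : ℝ) + ∑ i, ‖Fin.tail (α := fun _ => ℂ) t i‖ < R :=
    (isOpen_lt (continuous_const.add hsc) continuous_const).mem_nhds 
      (lt_add_one ((n : ℝ) + ∑ i, ‖Fin.tail (α := fun _ => ℂ) s i‖))
  refine ⟨fun j => C * 2 ^ R * (1 / ((j + 1 : ℕ) : ℝ) ^ (1 + δ)),
    ((summable_nat_add_iff 1).2 (Real.summable_one_div_nat_rpow.2 (by linarith))).mul_left _,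
    _, (hev'.and (h1.and h2)).and ((isOpen_firstRegion n).mem_nhds hs), fun t ht => ht.2, ?_⟩
  rintro j t ⟨⟨ht, ht1, ht2⟩, -⟩
  have hj : (0 : ℝ) ≤ j := Nat.cast_nonneg j
  refine (norm_firstSeries_term_le hC (by positivity) ht j).trans ?_
  simp only [one_div]
  rw [← Real.rpow_neg (by positivity)]
  push_cast
  have h3 : (2 : ℝ) ^ ((n : ℝ) + ∑ i, ‖Fin.tail (α := fun _ => ℂ) t i‖) ≤ 2 ^ R :=
    Real.rpow_le_rpow_of_exponent_le (by norm_num) ht2.le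
  have h4 : ((j : ℝ) + 1) ^ ((n : ℝ) + ∑ i, ‖Fin.tail (α := fun _ => ℂ) t i‖ - (t 0).re) ≤
      ((j : ℝ) + 1) ^ (-(1 + δ)) :=
    Real.rpow_le_rpow_of_exponent_le (by linarith) (by linarith)
  gcongr

theorem differentiableOn_firstSeries (n : ℕ) :
    DifferentiableOn ℂ (firstSeries n) (firstRegion n) := by
  refine differentiableOn_tsum_of_locally_summable (fun j => ?_)
    fun s hs => firstSeries_locally_dominated hs
  exact (differentiable_one_div_cpow_apply 0 j).differentiableOn.mul
    ((differentiableOn_tailZeta n (j + 1)).comp (differentiable_tail n).differentiableOn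
      fun s hs => hs.1)

theorem firstSeries_eq_series {n : ℕ} {s : Fin (n + 1) → ℂ}
    (hs : s ∈ multiZetaHalfSpace (n + 1)) : firstSeries n s = multiZetaSeries (n + 1) s := by
  rw [multiZetaSeries_eq_incSum, ← (incSum_gt_succ 0 hs).tsum_eq, firstSeries]
  refine tsum_congr fun j => ?_
  rw [tailZeta_eq_incSum n (j + 1) (Fin.tail_mem_multiZetaHalfSpace hs)]

/-- The half-space is adjoined because a continuation must live on a domain containing it. It
overlaps `firstRegion`, so the union is connected. -/
theorem isMultiZetaContinuation_firstSeries (n : ℕ) : IsMultiZetaContinuation (n + 1)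
    (firstRegion n ∪ multiZetaHalfSpace (n + 1)) (firstSeries n) where
  isOpen := (isOpen_firstRegion n).union (isOpen_multiZetaHalfSpace _)
  isPreconnected := by
    set a : Fin (n + 1) → ℂ := Fin.cons (((n : ℝ) + 2 + n * 2 : ℝ) : ℂ) (fun _ => 2) with ha
    have hn : (0 : ℝ) ≤ n := Nat.cast_nonneg n
    refine IsPreconnected.union a ⟨?_, ?_⟩ ?_ (isPreconnected_firstRegion n)
      (convex_multiZetaHalfSpace (n + 1)).isPreconnected
    · rw [ha, Fin.tail_cons]
      exact halfSpace_subset_tailRegular n (two_mem_multiZetaHalfSpace n)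
    · simp only [ha, Fin.tail_cons, Fin.cons_zero, Complex.ofReal_re]
      simp
    · intro i
      induction i using Fin.cases with
      | zero => rw [ha, Fin.cons_zero, Complex.ofReal_re]; linarith
      | succ i => simp [ha]
  halfSpace_subset := Set.subset_union_right
  differentiableOn := by
    refine (differentiableOn_firstSeries n).union_of_isOpen ?_ (isOpen_firstRegion n)
      (isOpen_multiZetaHalfSpace _)
    exact (differentiableOn_multiZetaSeries (n + 1)).congr fun s hs => firstSeries_eq_series hs
  eqOn := fun s hs => firstSeries_eq_series hs

/-- As the real part of the first variable grows, the zeta-function tends to `tailF`, locally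
uniformly in the other variables. -/
theorem multiZeta_near_tailF {n : ℕ} {ρ : Fin n → ℂ} (hρ : ρ ∈ tailRegular n) :
    ∃ V ∈ 𝓝 ρ, ∀ ε : ℝ, 0 < ε → ∃ R : ℝ, ∀ s : Fin (n + 1) → ℂ, Fin.tail s ∈ V → R < (s 0).re →
      s ∈ multiZetaRegular (n + 1) ∧ ‖multiZeta (n + 1) s - tailF n (Fin.tail s)‖ < ε := by
  obtain ⟨C, hC, hev⟩ := norm_tailZeta_le n hρ
  obtain ⟨E, hE⟩ : ∃ E, E = (n : ℝ) + ∑ i, ‖ρ i‖ + 1 := ⟨_, rfl⟩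
  have hE0 : 0 ≤ E := by rw [hE]; positivity
  have h2 : ∀ᶠ t : Fin n → ℂ in 𝓝 ρ, (n : ℝ) + ∑ i, ‖t i‖ < E :=
    (isOpen_lt (continuous_const.add (continuous_sum_norm n)) continuous_const).mem_nhds 
      (by rw [hE]; exact lt_add_one ((n : ℝ) + ∑ i, ‖ρ i‖))
  refine ⟨_, (hev.and h2).and ((isOpen_tailRegular n).mem_nhds hρ), fun ε hε => ?_⟩
  set S : ℝ := ∑' j : ℕ, ((j + 1 : ℕ) + 1 : ℝ) ^ (-2 : ℝ) with hS
  have hSsum : Summable fun j : ℕ => ((j + 1 : ℕ) + 1 : ℝ) ^ (-2 : ℝ) := by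
    have := (summable_nat_add_iff 2).2 (Real.summable_nat_rpow.2 (show (-2 : ℝ) < -1 by norm_num))
    refine this.congr fun j => ?_
    push_cast
    ring_nf
  have hlim : Tendsto (fun x : ℝ => C * 2 ^ E * S * (2 : ℝ) ^ (-(x - (E + 2)))) atTop (𝓝 0) := by
    have h3 : Tendsto (fun x : ℝ => (2 : ℝ) ^ (-(x - (E + 2)))) atTop (𝓝 0) :=
      (tendsto_rpow_atBot_of_base_gt_one 2 (by norm_num)).comp
        (tendsto_neg_atTop_atBot.comp (tendsto_atTop_add_const_right _ _ tendsto_id))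
    simpa using h3.const_mul (C * 2 ^ E * S)
  obtain ⟨R, hR⟩ := eventually_atTop.1 ((hlim.eventually_lt_const hε).and (eventually_ge_atTop (E + 2)))
  refine ⟨R, fun s hsV hsR => ?_⟩
  obtain ⟨⟨hs1, hs2⟩, hs3⟩ := hsV
  obtain ⟨hR1, hR2⟩ := hR (s 0).re hsR.le
  have hreg : s ∈ firstRegion n := ⟨hs3, by linarith⟩
  have hcont := isMultiZetaContinuation_firstSeries n
  refine ⟨hcont.subset_regular (Or.inl hreg), ?_⟩
  rw [hcont.multiZeta_eq (Or.inl hreg), tailF_eq_tailZeta]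
  have hb : ∀ N : ℕ, ‖tailZeta n N (Fin.tail s)‖ ≤ C * ((N : ℝ) + 1) ^ E := fun N =>
    (hs1 N).trans (mul_le_mul_of_nonneg_left (Real.rpow_le_rpow_of_exponent_le
      (by linarith [(Nat.cast_nonneg N : (0 : ℝ) ≤ N)]) hs2.le) hC)
  obtain ⟨u, hu, V, hV, -, huV⟩ := firstSeries_locally_dominated hreg
  have hsum : Summable fun j : ℕ => 1 / ((j + 1 : ℕ) : ℂ) ^ s 0 *
      tailZeta n (j + 1) (Fin.tail s) :=
    Summable.of_norm_bounded hu fun j => huV j s (mem_of_mem_nhds hV)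
  -- The term of index `0` belongs to `n_1 = 1` and is exactly `tailF`; only the terms with `n_1 ≥
  -- 2` remain to be bounded.
  rw [firstSeries, hsum.tsum_eq_zero_add]
  simp only [zero_add, Nat.cast_one, Complex.one_cpow, div_one, one_mul, add_sub_cancel_left]
  refine lt_of_le_of_lt ?_ hR1
  -- With `x = j + 2 ≥ 2`, write `x ^ (E - Re s_1)` as `x ^ (-(Re s_1 - E - 2))` times `x ^ (-2)`.
  -- The first factor is at most the same power of `2`, which is small, and the second is summable.
  refine tsum_of_norm_bounded (g := fun j : ℕ => C * 2 ^ E * (2 : ℝ) ^ (-((s 0).re - (E + 2))) *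
    ((j + 1 : ℕ) + 1 : ℝ) ^ (-2 : ℝ)) ?_ fun j => ?_
  · have := hSsum.hasSum.mul_left (C * 2 ^ E * (2 : ℝ) ^ (-((s 0).re - (E + 2))))
    rwa [← hS, mul_right_comm (C * 2 ^ E) _ S] at this
  · refine (norm_firstSeries_term_le hC hE0 hb (j + 1)).trans ?_
    have hj : (0 : ℝ) ≤ ((j + 1 : ℕ) : ℝ) := Nat.cast_nonneg _
    have hj1 : (1 : ℝ) ≤ ((j + 1 : ℕ) : ℝ) := by exact_mod_cast Nat.succ_pos j
    rw [show E - (s 0).re = -((s 0).re - (E + 2)) + -2 by ring, Real.rpow_add (by positivity),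
      mul_assoc (C * 2 ^ E)]
    have : (((j + 1 : ℕ) : ℝ) + 1) ^ (-((s 0).re - (E + 2))) ≤ 2 ^ (-((s 0).re - (E + 2))) :=
      Real.rpow_le_rpow_of_nonpos (by norm_num) (by linarith) (by linarith)
    gcongr

/-! ### The hypersurface approached by the zeros -/

theorem differentiableOn_tailF (n : ℕ) : DifferentiableOn ℂ (tailF n) (tailRegular n) :=
  (differentiableOn_tailZeta n 1).congr fun s _ => tailF_eq_tailZeta n s

theorem tailF_not_eventually_zero {n : ℕ} {ρ : Fin n → ℂ} (hρ : ρ ∈ tailRegular n) :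
    ¬ ∀ᶠ s in 𝓝 ρ, tailF n s = 0 := by
  intro h
  have h2 := two_mem_multiZetaHalfSpace n
  have h0 := eqOn_zero_of_isPreconnected (isOpen_tailRegular n) (isPreconnected_tailRegular n)
    (differentiableOn_tailF n) hρ h _ (halfSpace_subset_tailRegular n h2)
  rw [tailF_eq_tailZeta, tailZeta_eq_incSum n 1 h2] at h0
  exact incSum_gt_ne_zero n 1 h0

/-! ### Limits of zeros and existence of nearby zeros -/

theorem mem_tailHypersurface_of_tendsto {n : ℕ} {ρ : Fin n → ℂ} (hρ : ρ ∈ tailRegular n)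
    {s : ℕ → Fin (n + 1) → ℂ} (hs : ∀ m, s m ∈ multiZetaZeros (n + 1))
    (hre : Tendsto (fun m => (s m 0).re) atTop atTop)
    (ht : Tendsto (fun m => Fin.tail (s m)) atTop (𝓝 ρ)) : ρ ∈ tailHypersurface n := by
  refine ⟨hρ, ?_⟩
  have hc := ((differentiableOn_tailF n).differentiableAt
    ((isOpen_tailRegular n).mem_nhds hρ)).continuousAt
  refine tendsto_nhds_unique (hc.tendsto.comp ht) ?_
  obtain ⟨V, hV, hlim⟩ := multiZeta_near_tailF hρ
  rw [Metric.tendsto_nhds]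
  intro ε hε
  obtain ⟨R, hR⟩ := hlim ε hε
  filter_upwards [ht.eventually hV, hre.eventually_gt_atTop R] with m hm1 hm2
  have := (hR (s m) hm1 hm2).2
  rw [(hs m).2, zero_sub, norm_neg] at this
  simpa using this

/-- Hurwitz's argument, with a quantitative open mapping theorem in place of Rouché: on a complex
line through `ρ` where `tailF` is not identically zero, `ρ` is an isolated zero. With `s_1` fixed
and large, `ζ` is close to `tailF` on a small disc of that line, so its image there contains `0`. -/
theorem exists_zero_near {n : ℕ} {ρ : Fin n → ℂ} (hρ : ρ ∈ tailHypersurface n) {η : ℝ} (hη : 0 < η)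
    (R : ℝ) : ∃ s ∈ multiZetaZeros (n + 1), R < (s 0).re ∧ dist (Fin.tail s) ρ < η := by
  obtain ⟨V, hV, hlim⟩ := multiZeta_near_tailF hρ.1
  obtain ⟨r, hr, hrV⟩ := Metric.mem_nhds_iff.1 (inter_mem (inter_mem hV
    ((isOpen_tailRegular n).mem_nhds hρ.1)) (Metric.ball_mem_nhds ρ hη))
  obtain ⟨y, hy, hyr⟩ := ((Filter.not_eventually.1 (tailF_not_eventually_zero hρ.1)).and_eventually
    (Metric.ball_mem_nhds ρ hr)).exists
  set v := y - ρ with hv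
  set ℓ : ℂ → Fin n → ℂ := fun t => ρ + t • v with hℓ
  have hℓd : Differentiable ℂ ℓ := differentiable_complexLine ρ v
  have hvr : ‖v‖ < r := by rwa [hv, ← dist_eq_norm]
  set T : Set ℂ := ℓ ⁻¹' Metric.ball ρ r with hT
  have hTo : IsOpen T := Metric.isOpen_ball.preimage hℓd.continuous
  have hTc : IsPreconnected T :=
    (convex_preimage_complexLine (convex_ball ρ r) ρ v).isPreconnected
  have hball : Metric.closedBall (0 : ℂ) 1 ⊆ T := by
    intro t ht
    rw [mem_closedBall_zero_iff] at ht
    change ρ + t • v ∈ Metric.ball ρ r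
    rw [mem_ball_iff_norm, add_sub_cancel_left, norm_smul]
    nlinarith [norm_nonneg v]
  have h0T : (0 : ℂ) ∈ T := hball (by simp)
  have hℓ0 : ℓ 0 = ρ := by simp [hℓ]
  have hφ : DifferentiableOn ℂ (fun t => tailF n (ℓ t)) T :=
    (differentiableOn_tailF n).comp hℓd.differentiableOn fun t ht => (hrV ht).1.2
  have hne : ∀ᶠ t in 𝓝[≠] (0 : ℂ), tailF n (ℓ t) ≠ 0 := by
    rcases (hφ.analyticOnNhd hTo 0 h0T).eventually_eq_zero_or_eventually_ne_zero with h | h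
    · have := eqOn_zero_of_isPreconnected hTo hTc hφ h0T h 1 (hball (by simp))
      simp only [hℓ, hv, one_smul, add_sub_cancel] at this
      exact absurd this hy
    · exact h
  obtain ⟨d, hd, hdne⟩ := Metric.mem_nhdsWithin_iff.1 hne
  obtain ⟨δ, hδ0, hδ⟩ := exists_between (lt_min hd one_pos)
  have hδd : δ < d := hδ.trans_le (min_le_left _ _)
  have hδ1 : δ < 1 := hδ.trans_le (min_le_right _ _)
  have hδT : Metric.closedBall (0 : ℂ) δ ⊆ T := (Metric.closedBall_subset_closedBall hδ1.le).trans hball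
  have hsphere : ∀ t ∈ Metric.sphere (0 : ℂ) δ, tailF n (ℓ t) ≠ 0 := by
    intro t ht
    rw [mem_sphere_zero_iff_norm] at ht
    exact hdne ⟨by rw [mem_ball_zero_iff, ht]; exact hδd, fun h => by
      rw [Set.mem_singleton_iff] at h; rw [h, norm_zero] at ht; exact hδ0.ne ht⟩
  obtain ⟨t₀, ht₀, hmin⟩ := (isCompact_sphere (0 : ℂ) δ).exists_isMinOn
    (NormedSpace.sphere_nonempty.2 hδ0.le)
    ((hφ.continuousOn.mono (Metric.sphere_subset_closedBall.trans hδT)).norm)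
  set c := ‖tailF n (ℓ t₀)‖ with hc
  have hc0 : 0 < c := norm_pos_iff.2 (hsphere t₀ ht₀)
  -- With error `c / 8`, the value at the centre is below `c / 8`, and values on the circle differ
  -- from it by at least `c - 2 c / 8 = 3 c / 4`. The image of the disc then contains the ball of
  -- radius `3 c / 8` about the central value, hence `0`.
  obtain ⟨R', hR'⟩ := hlim (c / 8) (by positivity)
  set M : ℂ := ((max R R' + 1 : ℝ) : ℂ) with hM
  have hMre : M.re = max R R' + 1 := Complex.ofReal_re _
  set L : ℂ → Fin (n + 1) → ℂ := fun t => Fin.cons M (ℓ t) with hL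
  have hLd : Differentiable ℂ L := by
    refine differentiable_pi.2 fun i => ?_
    induction i using Fin.cases with
    | zero => simp only [hL, Fin.cons_zero]; exact differentiable_const _
    | succ i => simp only [hL, Fin.cons_succ]; exact differentiable_pi.1 hℓd i
  have hclose : ∀ t ∈ T, L t ∈ multiZetaRegular (n + 1) ∧
      ‖multiZeta (n + 1) (L t) - tailF n (ℓ t)‖ < c / 8 := by
    intro t ht
    have := hR' (L t) (by simpa [hL] using (hrV ht).1.1) (by
      simp only [hL, Fin.cons_zero, hMre]
      linarith [le_max_right R R'])
    simpa [hL] using this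
  have hf : DifferentiableOn ℂ (fun t => multiZeta (n + 1) (L t)) T :=
    (differentiableOn_multiZeta n).comp hLd.differentiableOn fun t ht => (hclose t ht).1
  have hf0 : ‖multiZeta (n + 1) (L 0)‖ < c / 8 := by
    have := (hclose 0 h0T).2
    rwa [hℓ0, hρ.2, sub_zero] at this
  have hfs : ∀ t ∈ Metric.sphere (0 : ℂ) δ,
      3 * c / 4 ≤ ‖multiZeta (n + 1) (L t) - multiZeta (n + 1) (L 0)‖ := by
    intro t ht
    have h1 := (hclose t (hδT (Metric.sphere_subset_closedBall ht))).2
    have h2 : c ≤ ‖tailF n (ℓ t)‖ := hmin ht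
    have h3 := norm_sub_norm_le (multiZeta (n + 1) (L t)) (multiZeta (n + 1) (L 0))
    have h4 := norm_sub_norm_le (tailF n (ℓ t)) (multiZeta (n + 1) (L t))
    rw [norm_sub_rev] at h4
    linarith
  have hfreq : ∃ᶠ t in 𝓝 (0 : ℂ), multiZeta (n + 1) (L t) ≠ multiZeta (n + 1) (L 0) := by
    intro h
    simp only [not_not] at h
    have := eqOn_of_isPreconnected hTo hTc hf (differentiableOn_const (multiZeta (n + 1) (L 0)))
      h0T h t₀ (hδT (Metric.sphere_subset_closedBall ht₀))
    have h2 := hfs t₀ ht₀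
    rw [this, sub_self, norm_zero] at h2
    linarith
  have himg := (hf.diffContOnCl_ball hδT).ball_subset_image_closedBall hδ0 hfs hfreq
  obtain ⟨t, ht, hzero⟩ := himg (show (0 : ℂ) ∈ _ by
    rw [mem_ball_iff_norm, zero_sub, norm_neg]
    linarith)
  refine ⟨L t, ⟨(hclose t (hδT ht)).1, hzero⟩, ?_, ?_⟩
  · simp only [hL, Fin.cons_zero, hMre]
    linarith [le_max_left R R']
  · simpa [hL] using (hrV (hδT ht)).2

/-- Here `n = r - 1`, so that `r ≥ 2` reads `1 ≤ n`. A point `s = (s_1, …, s_r)` of `ℂ^r` is a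
function on `Fin (n + 1)`: `s 0` is `s_1`, and `Fin.tail s` is `(s_2, …, s_r)`. -/
theorem theorem3 (n : ℕ) (hn : 1 ≤ n) :
    (∀ D : Set (Fin n → ℂ), Bornology.IsBounded D → closure D ⊆ tailRegular n →
      (∀ ε : ℝ, 0 < ε → ∃ R : ℝ, ∀ s ∈ multiZetaZeros (n + 1),
        R < (s 0).re → Fin.tail s ∈ D → ∃ ρ ∈ tailHypersurface n, dist (Fin.tail s) ρ < ε) ∧
      (∀ s : ℕ → Fin (n + 1) → ℂ,
        (∀ m, s m ∈ multiZetaZeros (n + 1)) →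
        (∀ m, Fin.tail (s m) ∈ D) →
        Tendsto (fun m => (s m 0).re) atTop atTop →
        (∀ ε : ℝ, 0 < ε → ∃ M : ℕ, ∀ m, M ≤ m →
          ∃ ρ ∈ tailHypersurface n, dist (Fin.tail (s m)) ρ < ε) ∧
        (∃ φ : ℕ → ℕ, StrictMono φ ∧ ∃ ρ ∈ tailHypersurface n,
          Tendsto (fun m => Fin.tail (s (φ m))) atTop (𝓝 ρ)))) ∧
    (∀ ρ ∈ tailHypersurface n, ∃ s : ℕ → Fin (n + 1) → ℂ,
      (∀ m, s m ∈ multiZetaZeros (n + 1)) ∧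
      Tendsto (fun m => (s m 0).re) atTop atTop ∧
      Tendsto (fun m => Fin.tail (s m)) atTop (𝓝 ρ)) := by
  refine ⟨fun D hD hcl => ?_, fun ρ hρ => ?_⟩
  · have hsub : ∀ s : ℕ → Fin (n + 1) → ℂ, (∀ m, s m ∈ multiZetaZeros (n + 1)) →
        (∀ m, Fin.tail (s m) ∈ D) → Tendsto (fun m => (s m 0).re) atTop atTop →
        ∃ φ : ℕ → ℕ, StrictMono φ ∧ ∃ ρ ∈ tailHypersurface n,
          Tendsto (fun m => Fin.tail (s (φ m))) atTop (𝓝 ρ) := by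
      intro s hs hsD hre
      obtain ⟨ρ, hρ, φ, hφ, hlim⟩ := (Metric.isCompact_of_isClosed_isBounded isClosed_closure
        hD.closure).tendsto_subseq (x := fun m => (Fin.tail (s m) : Fin n → ℂ))
        fun m => subset_closure (hsD m)
      exact ⟨φ, hφ, ρ, mem_tailHypersurface_of_tendsto (hcl hρ) (s := fun m => s (φ m))
        (fun m => hs _) (hre.comp hφ.tendsto_atTop) hlim, hlim⟩
    have hunif : ∀ ε : ℝ, 0 < ε → ∃ R : ℝ, ∀ s ∈ multiZetaZeros (n + 1),
        R < (s 0).re → Fin.tail s ∈ D → ∃ ρ ∈ tailHypersurface n, dist (Fin.tail s) ρ < ε := by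
      intro ε hε
      -- If no `R` worked, choosing a bad zero with `Re s_1 > m` for every `m` would give a sequence
      -- to which the subsequence statement applies.
      by_contra! hcon
      choose s hs hre hsD hfar using fun m : ℕ => hcon m
      obtain ⟨φ, -, ρ, hρ, hlim⟩ := hsub s hs hsD
        (tendsto_atTop_mono (fun m => (hre m).le) tendsto_natCast_atTop_atTop)
      obtain ⟨m, hm⟩ := (hlim.eventually (Metric.ball_mem_nhds ρ hε)).exists
      exact absurd hm (not_lt.2 (hfar (φ m) ρ hρ))
    refine ⟨hunif, fun s hs hsD hre => ⟨fun ε hε => ?_, hsub s hs hsD hre⟩⟩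
    obtain ⟨R, hR⟩ := hunif ε hε
    obtain ⟨M, hM⟩ := eventually_atTop.1 (hre.eventually_gt_atTop R)
    exact ⟨M, fun m hm => hR (s m) (hs m) (hM m hm) (hsD m)⟩
  · choose s hs hre hdist using fun m : ℕ =>
      exists_zero_near hρ (η := 1 / ((m : ℝ) + 1)) (by positivity) m
    refine ⟨s, hs, tendsto_atTop_mono (fun m => (hre m).le) tendsto_natCast_atTop_atTop, ?_⟩
    rw [tendsto_iff_dist_tendsto_zero]
    exact squeeze_zero (fun _ => dist_nonneg) (fun m => (hdist m).le)
      tendsto_one_div_add_atTop_nhds_zero_nat
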